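/- Let $n\geq 4$. Let $S_n$ be the star graph with vertex set $\{0,1,\dots,n-1\}$ and edges $\{0,i\}$, $1\leq i\leq n-1$, and let $\mathrm{PEnd}(S_n)$ be the monoid of all partial transformations $\alpha$ of $\{0,1,\dots,n-1\}$ such that, for all $u,v\in\mathrm{dom}(\alpha)$, if $\{u,v\}$ is an edge of $S_n$ then so is $\{u\alpha,v\alpha\}$. Maps are written on the right and composed from left to right. Consider the partial transformations of $\{0,1,\dots,n-1\}$ $$a_0=\begin{pmatrix}0&1&2&3&\cdots&n-1\\0&2&1&3&\cdots&n-1\end{pmatrix},\quad b_0=\begin{pmatrix}0&1&\cdots&n-2&n-1\\0&2&\cdots&n-1&1\end{pmatrix},\quad e_0=\begin{pmatrix}0&1&2&3&\cdots&n-1\\0&1&1&3&\cdots&n-1\end{pmatrix},$$ $$f_0=\begin{pmatrix}0&2&\cdots&n-1\\0&2&\cdots&n-1\end{pmatrix},\quad c=\begin{pmatrix}1&2&\cdots&n-1\\0&2&\cdots&n-1\end{pmatrix},\quad d=\begin{pmatrix}1&\cdots&n-1\\1&\cdots&n-1\end{pmatrix},\quad z=\begin{pmatrix}0&1&\cdots&n-1\\1&0&\cdots&0\end{pmatrix}.$$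 A presentation $\langle X\mid R\rangle$ is said to define a monoid $M$ on given elements of $M$ named by the letters of $X$ if the quotient of the free monoid $X^*$ by the congruence generated by $R$ is isomorphic to $M$, via an isomorphism that sends the class of each letter to the element it names. Let $R_0$ be any set of relations on the alphabet $\{a_0,b_0,e_0,f_0\}$ such that $\langle a_0,b_0,e_0,f_0\mid R_0\rangle$ defines, on the transformations $a_0,b_0,e_0,f_0$, the monoid of all partial transformations of $\{0,1,\dots,n-1\}$ that fix $0$ and map no other point to $0$ (a copy of the monoid of all partial transformations of $\{1,\dots,n-1\}$). Let $R_{\mathrm s}$ be $R_0$ together with the relations $$d^2=d,\quad a_0d=da_0,\quad b_0d=db_0,\quad e_0d=de_0,\quad f_0d=df_0,$$ $$a_0z=z,\quad b_0z=z,\quad e_0z=z,\quad dz=zf_0,\quad zd=(f_0b_0)^{n-1}z,$$ $$z^2=(e_0b_0)^{n-3}e_0,\quad d(f_0b_0)^{n-1}z=d(f_0b_0)^{n-1},$$ and let $R_c$ be $R_{\mathrm s}$ together with the ten relations $$c^2=f_0d,\quad cf_0=c,\quad f_0c=f_0d,\quad cd=f_0d,\quad dc=c,$$ $$cb_0^{n-2}a_0b_0=b_0^{n-2}a_0b_0c,\quad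 cb_0a_0=b_0a_0c,\quad ca_0f_0a_0=a_0f_0a_0c,$$ $$ca_0b_0^{n-2}a_0b_0e_0b_0^{n-2}a_0b_0a_0=a_0b_0^{n-2}a_0b_0e_0b_0^{n-2}a_0b_0a_0c,\quad czb_0^{n-2}=a_0(b_0e_0)^{n-3}c.$$ Then the presentation $\langle a_0,b_0,e_0,f_0,c,d,z\mid R_c\rangle$ defines the monoid $\mathrm{PEnd}(S_n)$ on the transformations $a_0,b_0,e_0,f_0,c,d,z$. -/

import Mathlib

namespace StarPres

/-- A partial transformation `α` of `Ω`: `α x = some y` means `x ∈ dom α` and `xα = y`, and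
`α x = none` means `x ∉ dom α`. -/
@[ext]
structure PT (Ω : Type*) where
  /-- The underlying partial function. -/
  toFun : Ω → Option Ω

instance {Ω : Type*} : CoeFun (PT Ω) (fun _ => Ω → Option Ω) := ⟨PT.toFun⟩

/-- Composition of partial transformations from left to right: `x(αβ) = (xα)β`. -/
instance {Ω : Type*} : Monoid (PT Ω) where
  mul α β := ⟨fun x => (α x).bind β⟩
  one := ⟨fun x => some x⟩
  mul_assoc α β γ := by
    refine PT.ext (funext fun x => ?_)
    exact Option.bind_assoc (α x) β γ
  one_mul α := rfl
  mul_one α := by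
    refine PT.ext (funext fun x => ?_)
    exact Option.bind_fun_some (α x)

theorem PT.mul_apply {Ω : Type*} (α β : PT Ω) (x : Ω) : (α * β) x = (α x).bind β := rfl

theorem PT.one_apply {Ω : Type*} (x : Ω) : (1 : PT Ω) x = some x := rfl

/-- The monoid of partial endomorphisms of a simple graph: the partial transformations `α` of the
vertex set such that `{u, v} ∈ E` implies `{uα, vα} ∈ E` for all `u, v ∈ dom α`. -/
def PEnd {V : Type*} (G : SimpleGraph V) : Submonoid (PT V) where
  carrier := {α | ∀ u v u' v' : V, α u = some u' → α v = some v' → G.Adj u v → G.Adj u' v'}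
  one_mem' := by
    intro u v u' v' hu hv h
    rw [PT.one_apply, Option.some.injEq] at hu hv
    exact hu ▸ hv ▸ h
  mul_mem' := by
    intro α β hα hβ u v u' v' hu hv h
    rw [PT.mul_apply, Option.bind_eq_some_iff] at hu hv
    obtain ⟨u₁, hu₁, hu₂⟩ := hu
    obtain ⟨v₁, hv₁, hv₂⟩ := hv
    exact hβ u₁ v₁ u' v' hu₂ hv₂ (hα u v u₁ v₁ hu₁ hv₁ h)

/-- The star graph `S_n` on the `n` vertices `0, 1, …, n - 1`, with centre `0`. -/
abbrev star (n : ℕ) [NeZero n] : SimpleGraph (Fin n) := SimpleGraph.starGraph 0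

/-- The copy in `PT {0, …, n - 1}` of the monoid of all partial transformations of
`{1, …, n - 1}`: the partial transformations that fix `0` and map no other point to `0`. -/
def PTzeta (n : ℕ) [NeZero n] : Submonoid (PT (Fin n)) where
  carrier := {α | α 0 = some 0 ∧ ∀ x : Fin n, x ≠ 0 → α x ≠ some 0}
  one_mem' := by
    refine ⟨rfl, fun x hx h => hx ?_⟩
    rwa [PT.one_apply, Option.some.injEq] at h
  mul_mem' := by
    rintro α β ⟨hα, hα'⟩ ⟨hβ, hβ'⟩
    refine ⟨?_, fun x hx h => ?_⟩
    · rw [PT.mul_apply, hα]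
      exact hβ
    · rw [PT.mul_apply, Option.bind_eq_some_iff] at h
      obtain ⟨y, hy, hy'⟩ := h
      by_cases hy0 : y = 0
      · exact hα' x hx (hy0 ▸ hy)
      · exact hβ' y hy0 hy'

section Generators

variable (n : ℕ) [NeZero n]

/-- `0 ↦ 0`, `1 ↦ 2`, `2 ↦ 1`, `i ↦ i` for `3 ≤ i`. -/
def ta : PT (Fin n) := ⟨fun x => if x = 1 then some 2 else if x = 2 then some 1 else some x⟩

/-- `0 ↦ 0`, `i ↦ i + 1` for `1 ≤ i ≤ n - 2`, `n - 1 ↦ 1`. -/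
def tb : PT (Fin n) := ⟨fun x =>
  if x = 0 then some 0 else if x.val = n - 1 then some 1 else some (x + 1)⟩

/-- `2 ↦ 1` and `i ↦ i` for `i ≠ 2`. -/
def te : PT (Fin n) := ⟨fun x => if x = 2 then some 1 else some x⟩

/-- The identity on `{0, 2, 3, …, n - 1}`. -/
def tf : PT (Fin n) := ⟨fun x => if x = 1 then none else some x⟩

/-- Undefined at `0`; `1 ↦ 0` and `i ↦ i` for `2 ≤ i`. -/
def tc : PT (Fin n) := ⟨fun x => if x = 0 then none else if x = 1 then some 0 else some x⟩

/-- The identity on `{1, 2, …, n - 1}`. -/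
def td : PT (Fin n) := ⟨fun x => if x = 0 then none else some x⟩

/-- `0 ↦ 1` and `i ↦ 0` for `1 ≤ i`. -/
def tz : PT (Fin n) := ⟨fun x => if x = 0 then some 1 else some 0⟩

end Generators

/-- The alphabet `{a₀, b₀, e₀, f₀}`. -/
inductive Letter0 : Type
  | a0 | b0 | e0 | f0

/-- The alphabet `{a₀, b₀, e₀, f₀, c, d, z}`. -/
inductive Letter : Type
  | a0 | b0 | e0 | f0 | c | d | z

/-- The transformations of `{0, …, n - 1}` named by the letters `a₀, b₀, e₀, f₀`. -/
def gen0 (n : ℕ) [NeZero n] : Letter0 → PT (Fin n)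
  | .a0 => ta n
  | .b0 => tb n
  | .e0 => te n
  | .f0 => tf n

/-- The transformations of `{0, …, n - 1}` named by the letters `a₀, b₀, e₀, f₀, c, d, z`. -/
def gen (n : ℕ) [NeZero n] : Letter → PT (Fin n)
  | .a0 => ta n
  | .b0 => tb n
  | .e0 => te n
  | .f0 => tf n
  | .c => tc n
  | .d => td n
  | .z => tz n

/-- The inclusion of the smaller alphabet in the larger one. -/
def Letter0.incl : Letter0 → Letter
  | .a0 => .a0
  | .b0 => .b0
  | .e0 => .e0
  | .f0 => .f0

/-- `⟨X ∣ R⟩` defines the submonoid `M` of `N` on the generators `g x`, `x ∈ X`: the quotient of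
the free monoid `X*` by the congruence generated by `R` is isomorphic to `M`, by an isomorphism
that sends the class of each letter `x` to `g x`. -/
def Defines {X N : Type*} [Monoid N] (R : Set (FreeMonoid X × FreeMonoid X)) (g : X → N)
    (M : Submonoid N) : Prop :=
  ∃ φ : (conGen fun u v : FreeMonoid X => (u, v) ∈ R).Quotient ≃* M,
    ∀ x : X, ((φ ((FreeMonoid.of x : FreeMonoid X) : (conGen _).Quotient) : M) : N) = g x

section Relations

/-- The letter as a word of length one. -/
abbrev a₀ : FreeMonoid Letter := FreeMonoid.of Letter.a0
/-- The letter as a word of length one. -/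
abbrev b₀ : FreeMonoid Letter := FreeMonoid.of Letter.b0
/-- The letter as a word of length one. -/
abbrev e₀ : FreeMonoid Letter := FreeMonoid.of Letter.e0
/-- The letter as a word of length one. -/
abbrev f₀ : FreeMonoid Letter := FreeMonoid.of Letter.f0
/-- The letter as a word of length one. -/
abbrev c : FreeMonoid Letter := FreeMonoid.of Letter.c
/-- The letter as a word of length one. -/
abbrev d : FreeMonoid Letter := FreeMonoid.of Letter.d
/-- The letter as a word of length one. -/
abbrev z : FreeMonoid Letter := FreeMonoid.of Letter.z

/-- Relations on `{a₀, b₀, e₀, f₀}` read as relations on `{a₀, b₀, e₀, f₀, c, d, z}`. -/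
def liftRel (R₀ : Set (FreeMonoid Letter0 × FreeMonoid Letter0)) :
    Set (FreeMonoid Letter × FreeMonoid Letter) :=
  Prod.map (FreeMonoid.map Letter0.incl) (FreeMonoid.map Letter0.incl) '' R₀

/-- `R_d`: the relations `R₀` and those that make `d` idempotent and central. -/
def Rd (R₀ : Set (FreeMonoid Letter0 × FreeMonoid Letter0)) :
    Set (FreeMonoid Letter × FreeMonoid Letter) :=
  liftRel R₀ ∪
    {(d ^ 2, d), (a₀ * d, d * a₀), (b₀ * d, d * b₀), (e₀ * d, d * e₀), (f₀ * d, d * f₀)}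

/-- `R_s`: the relations `R_d` and seven relations that involve `z`. -/
def Rs (n : ℕ) (R₀ : Set (FreeMonoid Letter0 × FreeMonoid Letter0)) :
    Set (FreeMonoid Letter × FreeMonoid Letter) :=
  Rd R₀ ∪
    {(a₀ * z, z), (b₀ * z, z), (e₀ * z, z), (d * z, z * f₀),
      (z * d, (f₀ * b₀) ^ (n - 1) * z),
      (z ^ 2, (e₀ * b₀) ^ (n - 3) * e₀),
      (d * (f₀ * b₀) ^ (n - 1) * z, d * (f₀ * b₀) ^ (n - 1))}

/-- `R_c`: the relations `R_s` and ten relations that involve `c`. -/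
def Rc (n : ℕ) (R₀ : Set (FreeMonoid Letter0 × FreeMonoid Letter0)) :
    Set (FreeMonoid Letter × FreeMonoid Letter) :=
  Rs n R₀ ∪
    {(c ^ 2, f₀ * d), (c * f₀, c), (f₀ * c, f₀ * d), (c * d, f₀ * d), (d * c, c),
      (c * b₀ ^ (n - 2) * a₀ * b₀, b₀ ^ (n - 2) * a₀ * b₀ * c),
      (c * b₀ * a₀, b₀ * a₀ * c),
      (c * a₀ * f₀ * a₀, a₀ * f₀ * a₀ * c),
      (c * a₀ * b₀ ^ (n - 2) * a₀ * b₀ * e₀ * b₀ ^ (n - 2) * a₀ * b₀ * a₀,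
        a₀ * b₀ ^ (n - 2) * a₀ * b₀ * e₀ * b₀ ^ (n - 2) * a₀ * b₀ * a₀ * c),
      (c * z * b₀ ^ (n - 2), a₀ * (b₀ * e₀) ^ (n - 3) * c)}

end Relations

end StarPres

/-!
Write `T` for `PTzeta n` and `P` for the monoid that the presentation defines. The hypothesis on `R₀`
gives a homomorphism `ι : T → P`, and the letters `c`, `d`, `z` give three more elements of `P`.

The relations speak of generators only, but they extend to `T`. Permutations, one transformation of
rank one less than the maximum and one partial identity generate the monoid of all partial
transformations of a finite set (`fixer_subset_of_swap_mem`). Hence `d` commutes with all of `T`,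
`t z = z` for every full `t ∈ T`, and `c` commutes with every `t ∈ T` that fixes `1` and maps no
other point to `1`, because the four words that the relations for `c` commute with `c` are a
transposition, a cycle, a collapse and a partial identity on `{2, …, n - 1}`. The resulting set of
relations is `IsStarModel`.

From these one computes all products of two letters `c`, `d`, `z` with an element of `T` between
them. The essential facts are `z t = z s` whenever `1t = 1s` (`IsStarModel.z_mul_congr`),
`d z = κ c` for the constant `κ` with value `1` (`IsStarModel.d_mul_z`), and that `z c` is the element
of `T` with domain `{0}` (`IsStarModel.z_mul_c`). Consequently the elements of the forms `t`, `d t`,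
`t c s` and `t z s` make up all of `P` (`isStarForm_of_word`).

A partial endomorphism `α` of the star is of one of three kinds: it fixes `0` and lies in `T`; or it
maps `0` to some `y ≠ 0` and the rest of its domain to `0`; or it is undefined at `0` and otherwise
arbitrary. Each `α` gets a representative `normalForm α` in `P`. In the last kind, if `x₀α = 0`, the
point `1` is traded for `x₀` by the transposition `(1 x₀)`. Every element of `P` is the normal form of
its image (`IsStarForm.normalForm_map`), and `normalForm α` has image `α` (`map_normalForm`), so the
map from `P` to the monoid of partial endomorphisms is bijective.
-/

namespace StarPres

/-! ### Generators of monoids of partial transformations -/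

section Generation

variable {Ω : Type*}

theorem PT.ext_apply {α β : PT Ω} (h : ∀ x, α x = β x) : α = β := PT.ext (funext h)

/-- A permutation as a partial transformation. Since partial transformations are composed from
left to right, this reverses products. -/
def ofPerm (σ : Equiv.Perm Ω) : PT Ω := ⟨fun x => some (σ x)⟩

theorem ofPerm_apply (σ : Equiv.Perm Ω) (x : Ω) : ofPerm σ x = some (σ x) := rfl

theorem ofPerm_mul (σ τ : Equiv.Perm Ω) : ofPerm (σ * τ) = ofPerm τ * ofPerm σ := rfl

theorem ofPerm_one : ofPerm (1 : Equiv.Perm Ω) = 1 := rfl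

theorem ofPerm_pow (σ : Equiv.Perm Ω) (k : ℕ) : ofPerm (σ ^ k) = ofPerm σ ^ k := by
  induction k with
  | zero => rfl
  | succ k ih => rw [pow_succ, ofPerm_mul, ih, pow_succ']

theorem ofPerm_inv_mem [Finite Ω] {S : Submonoid (PT Ω)} {σ : Equiv.Perm Ω}
    (h : ofPerm σ ∈ S) : ofPerm σ⁻¹ ∈ S := by
  have hpos : 0 < orderOf σ := orderOf_pos σ
  have : σ⁻¹ = σ ^ (orderOf σ - 1) := by
    rw [inv_eq_iff_mul_eq_one, ← pow_succ', Nat.sub_add_cancel hpos, pow_orderOf_eq_one]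
  rw [this, ofPerm_pow]
  exact pow_mem h _

variable [DecidableEq Ω]

/-- The transformation that sends `x` to `y` and fixes every other point. -/
def collapse (x y : Ω) : PT Ω := ⟨fun w => if w = x then some y else some w⟩

theorem collapse_apply (x y w : Ω) : collapse x y w = if w = x then some y else some w := rfl

/-- The partial identity that is undefined at `x` only. -/
def remove (x : Ω) : PT Ω := ⟨fun w => if w = x then none else some w⟩

theorem remove_apply (x w : Ω) : remove x w = if w = x then none else some w := rfl

theorem ofPerm_mem_of_swap_mem [Fintype Ω] {S : Submonoid (PT Ω)} {F : Set Ω}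
    (hswap : ∀ x y, x ∉ F → y ∉ F → ofPerm (Equiv.swap x y) ∈ S)
    (σ : Equiv.Perm Ω) (hσ : ∀ x ∈ F, σ x = x) : ofPerm σ ∈ S := by
  induction hk : σ.support.card using Nat.strong_induction_on generalizing σ with
  | _ k ih =>
    by_cases h1 : σ = 1
    · rw [h1]; exact S.one_mem
    obtain ⟨x, hx⟩ : ∃ x, σ x ≠ x := by
      by_contra! h; exact h1 (Equiv.ext h)
    have hxF : x ∉ F := fun h => hx (hσ x h)
    have hyF : σ x ∉ F := fun h => hx (σ.injective (hσ _ h))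
    have hlt := Equiv.Perm.card_support_swap_mul hx
    have key := ih _ (hk ▸ hlt) (Equiv.swap x (σ x) * σ) (fun w hw => by
      rw [Equiv.Perm.mul_apply, hσ w hw, Equiv.swap_apply_of_ne_of_ne]
      · rintro rfl; exact hxF hw
      · intro h; exact hyF (h ▸ hw)) rfl
    have : σ = Equiv.swap x (σ x) * (Equiv.swap x (σ x) * σ) := by
      rw [← mul_assoc, Equiv.swap_mul_self, one_mul]
    rw [this, ofPerm_mul]
    exact S.mul_mem key (hswap _ _ hxF hyF)

theorem ofPerm_mul_collapse_mul (σ : Equiv.Perm Ω) (x y : Ω) :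
    ofPerm σ * collapse (σ x) (σ y) * ofPerm σ⁻¹ = collapse x y := by
  refine PT.ext_apply fun v => ?_
  by_cases hv : v = x <;> simp [PT.mul_apply, ofPerm_apply, collapse_apply, hv]

theorem ofPerm_mul_remove_mul (σ : Equiv.Perm Ω) (x : Ω) :
    ofPerm σ * remove (σ x) * ofPerm σ⁻¹ = remove x := by
  refine PT.ext_apply fun v => ?_
  by_cases hv : v = x <;> simp [PT.mul_apply, ofPerm_apply, remove_apply, hv]

theorem collapse_mem_of_swap_mem [Finite Ω] {S : Submonoid (PT Ω)} {F : Set Ω}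
    (hswap : ∀ x y, x ∉ F → y ∉ F → ofPerm (Equiv.swap x y) ∈ S)
    {p q : Ω} (hp : p ∉ F) (hq : q ∉ F) (hpq : p ≠ q) (hS : collapse p q ∈ S)
    {x y : Ω} (hx : x ∉ F) (hy : y ∉ F) (hxy : x ≠ y) : collapse x y ∈ S := by
  set w := Equiv.swap x p y with hw
  have hwF : w ∉ F := by
    rw [hw, Equiv.swap_apply_def]; split_ifs <;> assumption
  have hwp : p ≠ w := by
    intro h
    apply hxy
    apply (Equiv.swap x p).injective
    rw [Equiv.swap_apply_left]; exact h
  have hσ : ofPerm (Equiv.swap w q * Equiv.swap x p) ∈ S :=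
    S.mul_mem (hswap _ _ hx hp) (hswap _ _ hwF hq)
  rw [← ofPerm_mul_collapse_mul (Equiv.swap w q * Equiv.swap x p)]
  refine S.mul_mem (S.mul_mem hσ ?_) (ofPerm_inv_mem hσ)
  rwa [Equiv.Perm.mul_apply, Equiv.Perm.mul_apply, Equiv.swap_apply_left, ← hw,
    Equiv.swap_apply_left, Equiv.swap_apply_of_ne_of_ne hwp hpq]

theorem remove_mem_of_swap_mem [Finite Ω] {S : Submonoid (PT Ω)} {F : Set Ω}
    (hswap : ∀ x y, x ∉ F → y ∉ F → ofPerm (Equiv.swap x y) ∈ S)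
    {p : Ω} (hp : p ∉ F) (hS : remove p ∈ S) {x : Ω} (hx : x ∉ F) : remove x ∈ S := by
  have hσ := hswap x p hx hp
  rw [← ofPerm_mul_remove_mul (Equiv.swap x p)]
  refine S.mul_mem (S.mul_mem hσ ?_) (ofPerm_inv_mem hσ)
  rwa [Equiv.swap_apply_left]

/-- The partial transformations that fix every point of `F` and map no other point into `F`. -/
def fixer (F : Set Ω) : Set (PT Ω) :=
  {α | (∀ x ∈ F, α x = some x) ∧ ∀ x y, α x = some y → y ∈ F → x ∈ F}

/-- If a full transformation is not injective, it identifies some `x ≠ y` and misses some `w`, so it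
is `collapse x y` followed by the transformation with `x ↦ w` instead, whose image is larger. -/
theorem full_mem_of_swap_mem [Fintype Ω] {S : Submonoid (PT Ω)} {F : Set Ω}
    (hswap : ∀ x y, x ∉ F → y ∉ F → ofPerm (Equiv.swap x y) ∈ S)
    {p q : Ω} (hp : p ∉ F) (hq : q ∉ F) (hpq : p ≠ q) (hS : collapse p q ∈ S)
    (g : Ω → Ω) (hg : (⟨fun x => some (g x)⟩ : PT Ω) ∈ fixer F) :
    (⟨fun x => some (g x)⟩ : PT Ω) ∈ S := by
  induction hk : (Finset.univ.filter fun w => ∀ x, g x ≠ w).card using Nat.strong_induction_on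
    generalizing g with
  | _ k ih =>
    obtain ⟨hg1, hg2⟩ := hg
    have hg1' : ∀ x ∈ F, g x = x := fun x hx => Option.some.inj (hg1 x hx)
    have hg2' : ∀ x, g x ∈ F → x ∈ F := fun x hx => hg2 x _ rfl hx
    by_cases hinj : Function.Injective g
    · exact ofPerm_mem_of_swap_mem hswap
        (Equiv.ofBijective g (Finite.injective_iff_bijective.mp hinj)) hg1'
    have hsurj : ¬ Function.Surjective g := fun h => hinj (Finite.injective_iff_surjective.mpr h)
    simp only [Function.Injective, Function.Surjective] at hinj hsurj
    push Not at hinj hsurj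
    obtain ⟨x, y, hxy, hne⟩ := hinj
    obtain ⟨w, hw⟩ := hsurj
    have hwF : w ∉ F := fun h => hw w (hg1' w h)
    have hxF : x ∉ F := by
      intro h
      have hy : y ∈ F := hg2' y (by rw [← hxy, hg1' x h]; exact h)
      rw [hg1' x h, hg1' y hy] at hxy
      exact hne hxy
    have hyF : y ∉ F := by
      intro h
      exact hxF (hg2' x (by rw [hxy, hg1' y h]; exact h))
    have e : (⟨fun x => some (g x)⟩ : PT Ω) =
        collapse x y * ⟨fun v => some (Function.update g x w v)⟩ := by
      refine PT.ext_apply fun v => ?_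
      rw [PT.mul_apply, collapse_apply]
      by_cases hv : v = x
      · subst hv; simp [Function.update_of_ne hne.symm, hxy]
      · simp [hv]
    rw [e]
    refine S.mul_mem (collapse_mem_of_swap_mem hswap hp hq hpq hS hxF hyF hne)
      (ih _ ?_ _ ⟨fun v hv => ?_, fun v u hv hu => ?_⟩ rfl)
    · rw [← hk]
      refine Finset.card_lt_card ⟨fun v hv => ?_, fun h => ?_⟩
      · simp only [Finset.mem_filter, Finset.mem_univ, true_and] at hv ⊢
        intro u hu
        by_cases hux : u = x
        · refine hv y ?_
          rw [Function.update_of_ne hne.symm, ← hxy, ← hux]; exact hu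
        · refine hv u ?_
          rw [Function.update_of_ne hux]; exact hu
      · have := h (by simpa using hw : w ∈ _)
        simp only [Finset.mem_filter, Finset.mem_univ, true_and] at this
        exact this x (by simp)
    · have : v ≠ x := by rintro rfl; exact hxF hv
      simp [Function.update_of_ne this, hg1' v hv]
    · simp only [Option.some.injEq] at hv
      by_cases hvx : v = x
      · subst hvx
        simp only [Function.update_self] at hv
        exact absurd (hv ▸ hu) hwF
      · rw [Function.update_of_ne hvx] at hv
        exact hg2' v (hv ▸ hu)

theorem fixer_subset_of_swap_mem [Fintype Ω] {S : Submonoid (PT Ω)} {F : Set Ω}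
    (hswap : ∀ x y, x ∉ F → y ∉ F → ofPerm (Equiv.swap x y) ∈ S)
    {p q r : Ω} (hp : p ∉ F) (hq : q ∉ F) (hpq : p ≠ q) (hS : collapse p q ∈ S)
    (hr : r ∉ F) (hS' : remove r ∈ S) : fixer F ⊆ S := by
  intro α hα
  induction hk : (Finset.univ.filter fun w => α w = none).card using Nat.strong_induction_on
    generalizing α with
  | _ k ih =>
    obtain ⟨hα1, hα2⟩ := hα
    by_cases h : ∀ x, α x ≠ none
    · have h' : ∀ x, ∃ y, α x = some y := fun x => Option.ne_none_iff_exists'.mp (h x)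
      choose g hg using h'
      have e : α = ⟨fun x => some (g x)⟩ := PT.ext_apply hg
      rw [e] at hα1 hα2 ⊢
      exact full_mem_of_swap_mem hswap hp hq hpq hS g ⟨hα1, hα2⟩
    push Not at h
    obtain ⟨x, hx⟩ := h
    have hxF : x ∉ F := fun h => by rw [hα1 x h] at hx; cases hx
    have e : α = remove x * ⟨Function.update α.toFun x (some x)⟩ := by
      refine PT.ext_apply fun v => ?_
      rw [PT.mul_apply, remove_apply]
      by_cases hv : v = x
      · subst hv; simp [hx]
      · simp [hv]
    rw [e]
    refine S.mul_mem (remove_mem_of_swap_mem hswap hr hS' hxF)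
      (ih _ ?_ ⟨fun v hv => ?_, fun v u hv hu => ?_⟩ rfl)
    · rw [← hk]
      refine Finset.card_lt_card ⟨fun v hv => ?_, fun h => ?_⟩
      · simp only [Finset.mem_filter, Finset.mem_univ, true_and] at hv ⊢
        by_cases hvx : v = x
        · rw [hvx]; exact hx
        · rwa [Function.update_of_ne hvx] at hv
      · have := h (by simpa using hx : x ∈ _)
        simp at this
    · have : v ≠ x := by rintro rfl; exact hxF hv
      simp only [Function.update_of_ne this, hα1 v hv]
    · by_cases hvx : v = x
      · subst hvx
        simp only [Function.update_self, Option.some.injEq] at hv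
        exact hv ▸ hu
      · simp only [Function.update_of_ne hvx] at hv
        exact hα2 v u hv hu

end Generation

section Cycle

variable {n : ℕ}

/-- The cycle `r ↦ r + 1 ↦ ⋯ ↦ n - 1 ↦ r` as a function. -/
def cycleFun (r : Fin n) (x : Fin n) : Fin n :=
  if x < r then x else if h : x.val + 1 < n then ⟨x.val + 1, h⟩ else r

theorem cycleFun_injective (r : Fin n) : Function.Injective (cycleFun r) := by
  intro x y h
  unfold cycleFun at h
  have hx := x.isLt
  have hy := y.isLt
  split_ifs at h <;> simp only [Fin.ext_iff, Fin.lt_def] at * <;> omega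

/-- The cycle `r ↦ r + 1 ↦ ⋯ ↦ n - 1 ↦ r` as a permutation. -/
noncomputable def cyclePerm (r : Fin n) : Equiv.Perm (Fin n) :=
  Equiv.ofBijective (cycleFun r) (Finite.injective_iff_bijective.mp (cycleFun_injective r))

theorem cyclePerm_apply (r x : Fin n) : cyclePerm r x = cycleFun r x := rfl

/-- Conjugating by the cycle gives all transpositions of neighbours, and those give the rest. -/
theorem swap_mem_of_cycle_mem {S : Submonoid (PT (Fin n))} {r s : Fin n}
    (hs : s.val = r.val + 1) (hcyc : ofPerm (cyclePerm r) ∈ S)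
    (hsw : ofPerm (Equiv.swap r s) ∈ S) :
    ∀ x y : Fin n, r ≤ x → r ≤ y → ofPerm (Equiv.swap x y) ∈ S := by
  have hadj : ∀ k : ℕ, ∀ h : r.val + k + 1 < n,
      ofPerm (Equiv.swap (⟨r.val + k, by omega⟩ : Fin n) ⟨r.val + k + 1, h⟩) ∈ S := by
    intro k
    induction k with
    | zero =>
      intro h
      have e : s = ⟨r.val + 0 + 1, h⟩ := Fin.ext hs
      exact e ▸ hsw
    | succ k ih =>
      intro h
      have h1 := ih (by omega)
      have e1 : cyclePerm r (⟨r.val + k, by omega⟩ : Fin n) = ⟨r.val + (k + 1), by omega⟩ := by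
        rw [cyclePerm_apply, cycleFun, if_neg (by simp [Fin.lt_def]), dif_pos (by simp; omega)]
        rfl
      have e2 : cyclePerm r (⟨r.val + k + 1, by omega⟩ : Fin n) =
          ⟨r.val + (k + 1) + 1, by omega⟩ := by
        rw [cyclePerm_apply, cycleFun, if_neg (by simp [Fin.lt_def]; omega),
          dif_pos (by simp; omega)]
        rfl
      rw [← e1, ← e2, Equiv.swap_apply_apply, ofPerm_mul, ofPerm_mul]
      exact S.mul_mem (ofPerm_inv_mem hcyc) (S.mul_mem h1 hcyc)
  have hle : ∀ k : ℕ, ∀ x y : Fin n, r ≤ x → y.val = x.val + k →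
      ofPerm (Equiv.swap x y) ∈ S := by
    intro k
    induction k with
    | zero =>
      intro x y _ h
      have : x = y := Fin.ext (by omega)
      rw [this, Equiv.swap_self]
      exact S.one_mem
    | succ k ih =>
      intro x y hx h
      rw [Fin.le_def] at hx
      have hy := y.isLt
      set w : Fin n := ⟨x.val + k, by omega⟩ with hw
      have h1 := ih x w hx rfl
      have h2 : ofPerm (Equiv.swap w y) ∈ S := by
        have := hadj (x.val + k - r.val) (by omega)
        convert this using 3
        · apply Fin.ext; simp [hw]; omega
        · apply Fin.ext; simp; omega
      rcases Nat.eq_zero_or_pos k with rfl | hk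
      · have : x = w := Fin.ext (by simp [hw])
        rwa [this]
      · have hxw : x ≠ w := by intro e; rw [Fin.ext_iff] at e; simp [hw] at e; omega
        have hxy : x ≠ y := by intro e; rw [Fin.ext_iff] at e; omega
        have e : Equiv.swap x y = Equiv.swap w y * Equiv.swap x w * Equiv.swap w y := by
          rw [Equiv.swap_mul_swap_mul_swap hxw hxy, Equiv.swap_comm]
        rw [e, ofPerm_mul, ofPerm_mul]
        exact S.mul_mem h2 (S.mul_mem h1 h2)
  intro x y hx hy
  rcases le_total x y with h | h
  · exact hle (y.val - x.val) x y hx (by rw [Fin.le_def] at h; omega)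
  · rw [Equiv.swap_comm]
    exact hle (x.val - y.val) y x hy (by rw [Fin.le_def] at h; omega)

end Cycle

/-! ### The copy of the partial transformations of `{1, …, n - 1}` -/

section StarElements

variable {n : ℕ} [NeZero n]

theorem val_one_of_le (hn : 4 ≤ n) : (1 : Fin n).val = 1 := by
  rw [Fin.val_one', Nat.mod_eq_of_lt (by omega)]

theorem val_two_of_le (hn : 4 ≤ n) : (2 : Fin n).val = 2 := by
  rw [Fin.coe_ofNat_eq_mod, Nat.mod_eq_of_lt (by omega)]

theorem val_three_of_le (hn : 4 ≤ n) : (3 : Fin n).val = 3 := by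
  rw [Fin.coe_ofNat_eq_mod, Nat.mod_eq_of_lt (by omega)]

theorem one_ne_zero_of_le (hn : 4 ≤ n) : (1 : Fin n) ≠ 0 := by
  rw [Ne, Fin.ext_iff, val_one_of_le hn]; simp

theorem PTzeta_mul_apply (s t : PTzeta n) (x : Fin n) : (s * t).1 x = (s.1 x).bind t.1 := rfl

theorem PTzeta_apply_zero (t : PTzeta n) : t.1 0 = some 0 := t.2.1

theorem PTzeta_apply_ne (t : PTzeta n) {x : Fin n} (hx : x ≠ 0) : t.1 x ≠ some 0 := t.2.2 x hx

theorem PTzeta_ext {s t : PTzeta n} (h : ∀ x, x ≠ 0 → s.1 x = t.1 x) : s = t := by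
  refine Subtype.ext (PT.ext_apply fun x => ?_)
  by_cases hx : x = 0
  · rw [hx, PTzeta_apply_zero, PTzeta_apply_zero]
  · exact h x hx

theorem PTzeta_subset_fixer : (PTzeta n : Set (PT (Fin n))) ⊆ fixer {0} := by
  rintro α ⟨h1, h2⟩
  refine ⟨fun x hx => ?_, fun x y hxy hy => ?_⟩
  · rw [Set.mem_singleton_iff.mp hx]; exact h1
  · rw [Set.mem_singleton_iff] at hy ⊢
    by_contra hx
    exact h2 x hx (hy ▸ hxy)

/-- The element of `PTzeta n` given by a partial function on the nonzero points; it is undefined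
at the nonzero points that `g` sends to `0`. -/
def zetaMk (g : Fin n → Option (Fin n)) : PTzeta n :=
  ⟨⟨fun x => if x = 0 then some 0 else if g x = some 0 then none else g x⟩, by
    refine ⟨by simp, fun x hx => ?_⟩
    simp only [if_neg hx]
    split_ifs with h
    · simp
    · exact h⟩

theorem zetaMk_apply (g : Fin n → Option (Fin n)) {x : Fin n} (hx : x ≠ 0) :
    (zetaMk g).1 x = if g x = some 0 then none else g x := if_neg hx

theorem zetaMk_coe (t : PTzeta n) : zetaMk t.1 = t :=
  PTzeta_ext fun x hx => by rw [zetaMk_apply _ hx, if_neg (PTzeta_apply_ne t hx)]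

/-- The transformation with domain `{0}`, which stands for the empty partial transformation of
`{1, …, n - 1}`. -/
def zetaEmpty : PTzeta n := zetaMk fun _ => none

/-- The transformation that sends every nonzero point to `y`, for `y ≠ 0`. -/
def zetaConst (y : Fin n) : PTzeta n := zetaMk fun _ => some y

/-- The partial identity on `0` and the domain of `α`. -/
def zetaDom (α : PT (Fin n)) : PTzeta n := zetaMk fun x => if α x = none then none else some x

/-- The partial identity on the points other than `1`. -/
def zetaRemoveOne : PTzeta n := zetaMk (remove 1)

theorem zetaEmpty_apply {x : Fin n} (hx : x ≠ 0) : (zetaEmpty : PTzeta n).1 x = none := by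
  simp [zetaEmpty, zetaMk_apply _ hx]

theorem zetaConst_apply {x y : Fin n} (hx : x ≠ 0) (hy : y ≠ 0) :
    (zetaConst y).1 x = some y := by
  simp [zetaConst, zetaMk_apply _ hx, hy]

theorem zetaDom_apply (α : PT (Fin n)) {x : Fin n} (hx : x ≠ 0) :
    (zetaDom α).1 x = if α x = none then none else some x := by
  rw [zetaDom, zetaMk_apply _ hx, if_neg]
  split_ifs <;> simp [hx]

theorem zetaRemoveOne_apply {x : Fin n} (hx : x ≠ 0) :
    (zetaRemoveOne : PTzeta n).1 x = if x = 1 then none else some x := by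
  rw [zetaRemoveOne, zetaMk_apply _ hx, remove_apply, if_neg]
  split_ifs <;> simp [hx]

/-- A partial transformation is the partial identity on its domain, followed by a full
transformation. -/
theorem exists_eq_zetaDom_mul (hn : 4 ≤ n) (t : PTzeta n) :
    ∃ s : PTzeta n, (∀ x, s.1 x ≠ none) ∧ t = zetaDom t.1 * s := by
  have h10 := one_ne_zero_of_le hn
  refine ⟨zetaMk fun x => some ((t.1 x).getD 1), fun x => ?_, PTzeta_ext fun x hx => ?_⟩
  · by_cases hx : x = 0
    · rw [hx, PTzeta_apply_zero]; simp
    · rw [zetaMk_apply _ hx]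
      cases h : t.1 x with
      | none => simp [h10]
      | some y =>
        have : y ≠ 0 := by rintro rfl; exact PTzeta_apply_ne t hx h
        simp [this]
  · rw [PTzeta_mul_apply, zetaDom_apply _ hx]
    cases h : t.1 x with
    | none => simp
    | some y =>
      have : y ≠ 0 := by rintro rfl; exact PTzeta_apply_ne t hx h
      simp [zetaMk_apply _ hx, h, this]

theorem te_eq_collapse : te n = collapse 2 1 := rfl

theorem tf_eq_remove : tf n = remove 1 := rfl

theorem ta_eq_ofPerm : ta n = ofPerm (Equiv.swap 1 2) := by
  refine PT.ext_apply fun x => ?_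
  simp only [ta, ofPerm_apply, Equiv.swap_apply_def]
  split_ifs <;> rfl

theorem tb_eq_ofPerm (hn : 4 ≤ n) : tb n = ofPerm (cyclePerm 1) := by
  refine PT.ext_apply fun x => ?_
  have h1 := val_one_of_le hn
  have hx := x.isLt
  simp only [tb, ofPerm_apply, cyclePerm_apply, cycleFun, Fin.lt_def, h1, Fin.ext_iff, Fin.val_zero]
  split_ifs <;> first | omega | rfl | skip
  · congr 1; apply Fin.ext; simp; omega
  · congr 1
    apply Fin.ext
    rw [Fin.val_add, h1, Nat.mod_eq_of_lt (by omega)]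

theorem cyclePerm_one_val (hn : 4 ≤ n) (x : Fin n) :
    (cyclePerm 1 x).val = if x.val = 0 then 0 else if x.val + 1 < n then x.val + 1 else 1 := by
  have h1 := val_one_of_le hn
  simp only [cyclePerm_apply, cycleFun, Fin.lt_def, h1]
  split_ifs <;> first | omega | rfl

theorem cyclePerm_one_pow_val (hn : 4 ≤ n) {k : ℕ} (hk : k ≤ n - 1) (x : Fin n) :
    ((cyclePerm 1 ^ k) x).val = if x.val = 0 then 0
      else if x.val + k < n then x.val + k else x.val + k - (n - 1) := by
  induction k with
  | zero => have := x.isLt; simp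
  | succ k ih =>
    have := ih (by omega)
    rw [pow_succ', Equiv.Perm.mul_apply, cyclePerm_one_val hn, this]
    have := x.isLt
    split_ifs <;> omega

theorem cyclePerm_one_pow (hn : 4 ≤ n) : cyclePerm (1 : Fin n) ^ (n - 2) = (cyclePerm 1)⁻¹ := by
  rw [eq_inv_iff_mul_eq_one, ← pow_succ, show n - 2 + 1 = n - 1 by omega]
  refine Equiv.ext fun x => Fin.ext ?_
  rw [cyclePerm_one_pow_val hn le_rfl, Equiv.Perm.one_apply]
  have := x.isLt
  split_ifs <;> omega

theorem tb_pow_mul_tb (hn : 4 ≤ n) : tb n ^ (n - 2) * tb n = 1 := by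
  rw [tb_eq_ofPerm hn, ← ofPerm_pow, cyclePerm_one_pow hn, ← ofPerm_mul, mul_inv_cancel, ofPerm_one]

/-- The transposition `(2 3)` as a word in the generators. -/
theorem tb_pow_mul_ta_mul_tb (hn : 4 ≤ n) :
    tb n ^ (n - 2) * ta n * tb n = ofPerm (Equiv.swap 2 3) := by
  rw [tb_eq_ofPerm hn, ← ofPerm_pow, cyclePerm_one_pow hn, ta_eq_ofPerm, ← ofPerm_mul, ← ofPerm_mul,
    ← mul_assoc, ← Equiv.swap_apply_apply]
  congr 2 <;> apply Fin.ext
  · rw [cyclePerm_one_val hn, val_one_of_le hn, val_two_of_le hn, if_neg (by omega),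
      if_pos (by omega)]
  · rw [cyclePerm_one_val hn, val_two_of_le hn, val_three_of_le hn, if_neg (by omega),
      if_pos (by omega)]

theorem tb_mul_ta (hn : 4 ≤ n) : tb n * ta n = ofPerm (cyclePerm 2) := by
  rw [tb_eq_ofPerm hn, ta_eq_ofPerm, ← ofPerm_mul]
  congr 1
  refine Equiv.ext fun x => Fin.ext ?_
  have h1 := val_one_of_le hn
  have h2 := val_two_of_le hn
  have hx := x.isLt
  have hb := cyclePerm_one_val hn x
  rw [Equiv.Perm.mul_apply, Equiv.swap_apply_def, cyclePerm_apply 2]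
  generalize cyclePerm 1 x = y at hb
  simp only [Fin.ext_iff, cycleFun, Fin.lt_def, h1, h2]
  split_ifs at hb ⊢ <;> (try simp only [h1, h2]) <;> omega

theorem ta_mul_tf_mul_ta : ta n * tf n * ta n = remove 2 := by
  rw [ta_eq_ofPerm, tf_eq_remove, ← ofPerm_mul_remove_mul (Equiv.swap 1 2) 2,
    Equiv.swap_apply_right, Equiv.swap_inv]

theorem collapse_three_two_eq (hn : 4 ≤ n) :
    ta n * tb n ^ (n - 2) * ta n * tb n * te n * tb n ^ (n - 2) * ta n * tb n * ta n =
      collapse 3 2 := by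
  have e : ta n * tb n ^ (n - 2) * ta n * tb n * te n * tb n ^ (n - 2) * ta n * tb n * ta n =
      ta n * ((tb n ^ (n - 2) * ta n * tb n) * te n * (tb n ^ (n - 2) * ta n * tb n)) * ta n := by
    simp only [mul_assoc]
  have h1 := val_one_of_le hn
  have h2 := val_two_of_le hn
  have h3 := val_three_of_le hn
  have s1 : Equiv.swap (2 : Fin n) 3 3 = 2 := Equiv.swap_apply_right _ _
  have s2 : Equiv.swap (2 : Fin n) 3 1 = 1 :=
    Equiv.swap_apply_of_ne_of_ne (by rw [Ne, Fin.ext_iff]; omega) (by rw [Ne, Fin.ext_iff]; omega)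
  have s3 : Equiv.swap (1 : Fin n) 2 3 = 3 :=
    Equiv.swap_apply_of_ne_of_ne (by rw [Ne, Fin.ext_iff]; omega) (by rw [Ne, Fin.ext_iff]; omega)
  have s4 : Equiv.swap (1 : Fin n) 2 2 = 1 := Equiv.swap_apply_right _ _
  have c1 := ofPerm_mul_collapse_mul (Equiv.swap (2 : Fin n) 3) 3 1
  have c2 := ofPerm_mul_collapse_mul (Equiv.swap (1 : Fin n) 2) 3 2
  rw [s1, s2, Equiv.swap_inv] at c1
  rw [s3, s4, Equiv.swap_inv] at c2
  rw [e, tb_pow_mul_ta_mul_tb hn, te_eq_collapse, c1, ta_eq_ofPerm, c2]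

theorem tb_apply_val (hn : 4 ≤ n) {x : Fin n} (hx : x ≠ 0) :
    ∃ y, tb n x = some y ∧ y ≠ 0 ∧ (x.val + 1 < n → y.val = x.val + 1) ∧
      (x.val + 1 = n → y.val = 1) := by
  have hx' : x.val ≠ 0 := fun h => hx (Fin.ext h)
  have := x.isLt
  have h := cyclePerm_one_val hn x
  refine ⟨cyclePerm 1 x, by rw [tb_eq_ofPerm hn, ofPerm_apply], ?_, ?_, ?_⟩
  · intro e; rw [e] at h; simp only [Fin.val_zero] at h; split_ifs at h <;> omega
  · intro; rw [h]; split_ifs <;> omega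
  · intro; rw [h]; split_ifs <;> omega

theorem ta_mem_PTzeta (hn : 4 ≤ n) : ta n ∈ PTzeta n := by
  have h1 := val_one_of_le hn
  have h2 := val_two_of_le hn
  refine ⟨?_, fun x hx => ?_⟩
  · simp only [ta, Fin.ext_iff, h1, h2, Fin.val_zero]
    simp
  · have : x.val ≠ 0 := fun h => hx (Fin.ext h)
    simp only [ta, Fin.ext_iff, h1, h2]
    split_ifs <;> simp only [ne_eq, Option.some.injEq, Fin.ext_iff, h1, h2, Fin.val_zero] <;> omega

theorem tb_mem_PTzeta (hn : 4 ≤ n) : tb n ∈ PTzeta n := by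
  refine ⟨by simp [tb], fun x hx => ?_⟩
  obtain ⟨y, hy, hy0, -⟩ := tb_apply_val hn hx
  rw [hy, Ne, Option.some.injEq]
  exact hy0

theorem te_mem_PTzeta (hn : 4 ≤ n) : te n ∈ PTzeta n := by
  have h1 := val_one_of_le hn
  have h2 := val_two_of_le hn
  refine ⟨?_, fun x hx => ?_⟩
  · simp only [te, Fin.ext_iff, h2, Fin.val_zero]
    simp
  · have : x.val ≠ 0 := fun h => hx (Fin.ext h)
    simp only [te, Fin.ext_iff, h2]
    split_ifs <;> simp only [ne_eq, Option.some.injEq, Fin.ext_iff, h1, Fin.val_zero] <;> omega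

theorem tf_mem_PTzeta (hn : 4 ≤ n) : tf n ∈ PTzeta n := by
  have h1 := val_one_of_le hn
  refine ⟨?_, fun x hx => ?_⟩
  · simp only [tf, Fin.ext_iff, h1, Fin.val_zero]
    simp
  · simp only [tf]
    split_ifs <;> simp [hx]

theorem pow_apply_zero {α : PT (Fin n)} (hα : α ∈ PTzeta n) (k : ℕ) : (α ^ k) 0 = some 0 :=
  (pow_mem hα k).1

theorem tf_mul_tb_pow_apply (hn : 4 ≤ n) (k : ℕ) {x : Fin n} (hx : x ≠ 0)
    (h : (x = 1 ∧ 1 ≤ k) ∨ n + 1 ≤ k + x.val) : ((tf n * tb n) ^ k) x = none := by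
  have h1 := val_one_of_le hn
  induction k generalizing x with
  | zero => have := x.isLt; omega
  | succ k ih =>
    rw [pow_succ', PT.mul_apply, PT.mul_apply, tf_eq_remove, remove_apply]
    by_cases hx1 : x = 1
    · simp [hx1]
    · obtain ⟨y, hy, hy0, hy1, hy2⟩ := tb_apply_val hn hx
      have hxlt := x.isLt
      rw [if_neg hx1, Option.bind_some, hy, Option.bind_some]
      apply ih hy0
      simp only [Fin.ext_iff, h1] at *
      omega

theorem tf_mul_tb_pow (hn : 4 ≤ n) : (tf n * tb n) ^ (n - 1) = (zetaEmpty : PTzeta n).1 := by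
  have h1 := val_one_of_le hn
  refine PT.ext_apply fun x => ?_
  by_cases hx : x = 0
  · subst hx
    rw [PTzeta_apply_zero]
    exact pow_apply_zero (mul_mem (tf_mem_PTzeta hn) (tb_mem_PTzeta hn)) _
  · rw [zetaEmpty_apply hx]
    apply tf_mul_tb_pow_apply hn _ hx
    have : x.val ≠ 0 := fun h => hx (Fin.ext h)
    rw [Fin.ext_iff, h1]
    omega

theorem te_mul_tb_pow_apply (hn : 4 ≤ n) (k : ℕ) {x : Fin n} (hx : x ≠ 0)
    (h : x.val ≤ 2 ∨ n ≤ k + x.val) :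
    ((te n * tb n) ^ k) x = some 1 ∨ ((te n * tb n) ^ k) x = some 2 := by
  have h1 := val_one_of_le hn
  have h2 := val_two_of_le hn
  induction k generalizing x with
  | zero =>
    have := x.isLt
    have : x.val ≠ 0 := fun h => hx (Fin.ext h)
    simp only [pow_zero, PT.one_apply, Option.some.injEq, Fin.ext_iff, h1, h2]
    omega
  | succ k ih =>
    have h10 : (1 : Fin n) ≠ 0 := by rw [Ne, Fin.ext_iff, h1]; simp
    rw [pow_succ', PT.mul_apply, PT.mul_apply, te_eq_collapse, collapse_apply]
    by_cases hx2 : x = 2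
    · obtain ⟨y, hy, hy0, hy1, hy2⟩ := tb_apply_val hn h10
      rw [if_pos hx2, Option.bind_some, hy, Option.bind_some]
      apply ih hy0
      omega
    · obtain ⟨y, hy, hy0, hy1, hy2⟩ := tb_apply_val hn hx
      have hxlt := x.isLt
      rw [if_neg hx2, Option.bind_some, hy, Option.bind_some]
      apply ih hy0
      simp only [Fin.ext_iff, h2] at *
      omega

theorem te_mul_tb_pow_mul_te (hn : 4 ≤ n) :
    (te n * tb n) ^ (n - 3) * te n = (zetaConst 1 : PTzeta n).1 := by
  have h1 := val_one_of_le hn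
  have h2 := val_two_of_le hn
  have h10 : (1 : Fin n) ≠ 0 := by rw [Ne, Fin.ext_iff, h1]; simp
  have h12 : (1 : Fin n) ≠ 2 := by rw [Ne, Fin.ext_iff, h1, h2]; simp
  refine PT.ext_apply fun x => ?_
  rw [PT.mul_apply]
  by_cases hx : x = 0
  · subst hx
    rw [PTzeta_apply_zero, pow_apply_zero (mul_mem (te_mem_PTzeta hn) (tb_mem_PTzeta hn)),
      Option.bind_some, (te_mem_PTzeta hn).1]
  · have : x.val ≠ 0 := fun h => hx (Fin.ext h)
    rw [zetaConst_apply hx h10]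
    rcases te_mul_tb_pow_apply hn (n - 3) hx (by omega) with h | h
    · rw [h, Option.bind_some, te_eq_collapse, collapse_apply, if_neg h12]
    · rw [h, Option.bind_some, te_eq_collapse, collapse_apply, if_pos rfl]

theorem tb_mul_te_apply (hn : 4 ≤ n) {x : Fin n} (hx : x ≠ 0) :
    ∃ y, (tb n * te n) x = some y ∧ y ≠ 0 ∧
      (2 ≤ x.val → x.val + 1 < n → y.val = x.val + 1) ∧
      (x = 1 ∨ x.val + 1 = n → y = 1) := by
  have h1 := val_one_of_le hn
  have h2 := val_two_of_le hn
  have h10 : (1 : Fin n) ≠ 0 := by rw [Ne, Fin.ext_iff, h1]; simp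
  obtain ⟨y, hy, hy0, hy1, hy2⟩ := tb_apply_val hn hx
  rw [PT.mul_apply, hy, Option.bind_some, te_eq_collapse, collapse_apply]
  by_cases hy3 : y = 2
  · refine ⟨1, if_pos hy3, h10, ?_, fun _ => rfl⟩
    intro h h'
    have := hy1 h'
    rw [hy3, h2] at this
    omega
  · refine ⟨y, if_neg hy3, hy0, fun _ => hy1, fun h => ?_⟩
    simp only [Fin.ext_iff, h1, h2] at *
    omega

theorem tb_mul_te_pow_apply (hn : 4 ≤ n) (k : ℕ) {x : Fin n} (hx : x ≠ 0) :
    ∃ y, ((tb n * te n) ^ k) x = some y ∧ (2 ≤ x.val → x.val + k < n → y.val = x.val + k) ∧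
      (x = 1 ∨ n ≤ x.val + k → y = 1) := by
  have h1 := val_one_of_le hn
  induction k generalizing x with
  | zero =>
    have := x.isLt
    refine ⟨x, rfl, fun _ _ => rfl, fun h => ?_⟩
    rcases h with h | h
    · exact h
    · omega
  | succ k ih =>
    obtain ⟨y, hy, hy0, hy1, hy2⟩ := tb_mul_te_apply hn hx
    obtain ⟨w, hw, hw1, hw2⟩ := ih hy0
    refine ⟨w, by rw [pow_succ', PT.mul_apply, hy, Option.bind_some, hw], ?_, ?_⟩
    · intro h h'
      have := hy1 h (by omega)
      have := hw1 (by omega) (by omega)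
      omega
    · intro h
      apply hw2
      by_cases hc : x = 1 ∨ x.val + 1 = n
      · exact Or.inl (hy2 hc)
      · right
        have hxlt := x.isLt
        have : x.val ≠ 0 := fun h => hx (Fin.ext h)
        simp only [Fin.ext_iff, h1] at h hc
        have := hy1 (by omega) (by omega)
        omega

/-- The transformation with `1 ↦ n - 1` and `x ↦ 1` for the other nonzero points. -/
def zetaLast : PTzeta n := zetaMk fun x => if x = 1 then some (Fin.rev 0) else some 1

theorem zetaLast_apply (hn : 4 ≤ n) {x : Fin n} (hx : x ≠ 0) :
    (zetaLast : PTzeta n).1 x = if x = 1 then some (Fin.rev 0) else some 1 := by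
  rw [zetaLast, zetaMk_apply _ hx, if_neg]
  have h1 := val_one_of_le hn
  split_ifs
  · simp [Fin.ext_iff, Fin.val_rev]; omega
  · rw [Option.some.injEq, Fin.ext_iff, h1]; simp

theorem ta_mul_tb_mul_te_pow (hn : 4 ≤ n) :
    ta n * (tb n * te n) ^ (n - 3) = (zetaLast : PTzeta n).1 := by
  have h1 := val_one_of_le hn
  have h2 := val_two_of_le hn
  have h10 : (1 : Fin n) ≠ 0 := by rw [Ne, Fin.ext_iff, h1]; simp
  have h20 : (2 : Fin n) ≠ 0 := by rw [Ne, Fin.ext_iff, h2]; simp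
  refine PT.ext_apply fun x => ?_
  rw [PT.mul_apply]
  by_cases hx : x = 0
  · subst hx
    rw [PTzeta_apply_zero, (ta_mem_PTzeta hn).1, Option.bind_some,
      pow_apply_zero (mul_mem (tb_mem_PTzeta hn) (te_mem_PTzeta hn))]
  · rw [zetaLast_apply hn hx]
    simp only [ta]
    split_ifs with hx1 hx2
    · obtain ⟨y, hy, hy1, -⟩ := tb_mul_te_pow_apply hn (n - 3) h20
      rw [Option.bind_some, hy]
      congr 1
      apply Fin.ext
      have := hy1 h2.ge (by omega)
      simp [Fin.val_rev]
      omega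
    · obtain ⟨y, hy, -, hy2⟩ := tb_mul_te_pow_apply hn (n - 3) h10
      rw [Option.bind_some, hy, hy2 (Or.inl rfl)]
    · obtain ⟨y, hy, -, hy2⟩ := tb_mul_te_pow_apply hn (n - 3) hx
      rw [Option.bind_some, hy, hy2]
      right
      have : x.val ≠ 0 := fun h => hx (Fin.ext h)
      simp only [Fin.ext_iff, h1, h2] at hx1 hx2
      omega

end StarElements

/-! ### Consequences of the relations, and the forms of the elements -/

section Model

variable {n : ℕ} [NeZero n] {P : Type*} [Monoid P]

/-- The relations of the presentation, in a monoid `P` that receives a homomorphism `ι` from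
`PTzeta n`, with `C`, `D`, `Z` for the letters `c`, `d`, `z`. The relations between a generator of
`PTzeta n` and `C`, `D` or `Z` are replaced by what they say about all elements of `PTzeta n`. -/
structure IsStarModel (ι : PTzeta n →* P) (C D Z : P) : Prop where
  dd : D * D = D
  td : ∀ t, ι t * D = D * ι t
  tz : ∀ t : PTzeta n, (∀ x, t.1 x ≠ none) → ι t * Z = Z
  dz : D * Z = Z * ι zetaRemoveOne
  zd : Z * D = ι zetaEmpty * Z
  zz : Z * Z = ι (zetaConst 1)
  cc : C * C = ι zetaRemoveOne * D
  cf : C * ι zetaRemoveOne = C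
  fc : ι zetaRemoveOne * C = ι zetaRemoveOne * D
  cd : C * D = ι zetaRemoveOne * D
  dc : D * C = C
  ct : ∀ t : PTzeta n, t.1 1 = some 1 → (∀ x, t.1 x = some 1 → x = 1) → C * ι t = ι t * C
  czb : ∀ t : PTzeta n, t.1 = tb n ^ (n - 2) → C * Z * ι t = ι zetaLast * C

namespace IsStarModel

variable {ι : PTzeta n →* P} {C D Z : P}

variable (h : IsStarModel ι C D Z)
include h

/-- Only the domain of `t` matters in `ι t * Z`. -/
theorem mul_z (hn : 4 ≤ n) (t : PTzeta n) : ι t * Z = ι (zetaDom t.1) * Z := by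
  obtain ⟨s, hs, e⟩ := exists_eq_zetaDom_mul hn t
  conv_lhs => rw [e]
  rw [map_mul, mul_assoc, h.tz s hs]

theorem const_mul_z {y : Fin n} (hy : y ≠ 0) : ι (zetaConst y) * Z = Z := by
  refine h.tz _ fun x => ?_
  by_cases hx : x = 0
  · rw [hx, PTzeta_apply_zero]; simp
  · rw [zetaConst_apply hx hy]; simp

/-- Both sides are `Z ^ 3`. -/
theorem z_mul_const_one (hn : 4 ≤ n) : Z * ι (zetaConst 1) = Z := by
  rw [← h.zz, ← mul_assoc, h.zz, h.const_mul_z (one_ne_zero_of_le hn)]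

/-- Only the image of `1` under `t` matters in `Z * ι t`. -/
theorem z_mul_congr (hn : 4 ≤ n) {s t : PTzeta n} (hst : s.1 1 = t.1 1) :
    Z * ι s = Z * ι t := by
  have e : zetaConst 1 * s = zetaConst 1 * t := PTzeta_ext fun x hx => by
    rw [PTzeta_mul_apply, PTzeta_mul_apply, zetaConst_apply hx (one_ne_zero_of_le hn),
      Option.bind_some, Option.bind_some, hst]
  rw [← h.z_mul_const_one hn, mul_assoc, mul_assoc, ← map_mul, ← map_mul, e]

/-- Since `C = C * ι zetaRemoveOne`, only the values of `t` outside `{0, 1}` matter in `C * ι t`. -/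
theorem c_mul_congr {s t : PTzeta n} (hst : ∀ x, x ≠ 0 → x ≠ 1 → s.1 x = t.1 x) :
    C * ι s = C * ι t := by
  have e : zetaRemoveOne * s = zetaRemoveOne * t := PTzeta_ext fun x hx => by
    rw [PTzeta_mul_apply, PTzeta_mul_apply, zetaRemoveOne_apply hx]
    split_ifs with h1
    · rfl
    · exact hst x hx h1
  rw [← h.cf, mul_assoc, mul_assoc, ← map_mul, ← map_mul, e]

/-- If `1` is not in the image of `t`, then `t = t * zetaRemoveOne`, and `fc` applies. -/
theorem mul_c_of_avoid {t : PTzeta n} (ht : ∀ x, t.1 x ≠ some 1) : ι t * C = D * ι t := by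
  have e : t = t * zetaRemoveOne := PTzeta_ext fun x hx => by
    rw [PTzeta_mul_apply]
    cases hx' : t.1 x with
    | none => rfl
    | some y =>
      have h0 : y ≠ 0 := by rintro rfl; exact PTzeta_apply_ne t hx hx'
      have h1 : y ≠ 1 := by rintro rfl; exact ht x hx'
      simp [zetaRemoveOne_apply h0, h1]
  rw [e, map_mul, mul_assoc, h.fc, ← mul_assoc, ← map_mul, h.td]

/-- Let `g` be the partial identity on `{0, 1}`. It commutes with `C`, so `ι (zetaConst 1) * C` ends
in `C * ι g`, which absorbs every `ι t` because `C` ignores what happens at `1`. -/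
theorem const_one_mul_c_mul (hn : 4 ≤ n) (t : PTzeta n) :
    ι (zetaConst 1) * C * ι t = ι (zetaConst 1) * C := by
  have h10 := one_ne_zero_of_le hn
  set g : PTzeta n := zetaMk fun x => if x = 1 then some 1 else none with hg
  have hg1 : g.1 1 = some 1 := by simp [hg, zetaMk_apply _ h10, h10]
  have hg2 : ∀ x, x ≠ 0 → x ≠ 1 → g.1 x = none := fun x hx hx1 => by
    simp [hg, zetaMk_apply _ hx, hx1]
  have e : zetaConst 1 * g = zetaConst 1 := PTzeta_ext fun x hx => by
    rw [PTzeta_mul_apply, zetaConst_apply hx h10, Option.bind_some, hg1]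
  have hc : C * ι g = ι g * C := h.ct g hg1 fun x hx => by
    by_contra hx1
    by_cases hx0 : x = 0
    · rw [hx0, PTzeta_apply_zero, Option.some.injEq] at hx
      exact h10 hx.symm
    · rw [hg2 x hx0 hx1] at hx; cases hx
  have hc' : C * ι (g * t) = C * ι g := h.c_mul_congr fun x hx hx1 => by
    rw [PTzeta_mul_apply, hg2 x hx hx1]; rfl
  rw [← e, map_mul, mul_assoc (ι (zetaConst 1)), ← hc, mul_assoc, mul_assoc, ← map_mul, hc']

/-- The last relation of the presentation, solved for `cz`. -/
theorem c_mul_z (hn : 4 ≤ n) : ∃ b : PTzeta n, b.1 (Fin.rev 0) = some 1 ∧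
    C * Z = ι zetaLast * C * ι b := by
  have hb := tb_mem_PTzeta hn
  have hl0 : (Fin.rev 0 : Fin n) ≠ 0 := by rw [Ne, Fin.ext_iff, Fin.val_rev]; simp; omega
  have hbb : (⟨tb n, hb⟩ ^ (n - 2) * ⟨tb n, hb⟩ : PTzeta n) = 1 := Subtype.ext (tb_pow_mul_tb hn)
  refine ⟨⟨tb n, hb⟩, ?_, ?_⟩
  · obtain ⟨y, hy, -, -, hy1⟩ := tb_apply_val hn hl0
    rw [hy, Option.some.injEq, Fin.ext_iff, val_one_of_le hn]
    exact hy1 (by rw [Fin.val_rev]; simp; omega)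
  · rw [← h.czb (⟨tb n, hb⟩ ^ (n - 2)) rfl, mul_assoc, ← map_mul, hbb, map_one, mul_one]

/-- Both sides are `ι (zetaConst 2) * C * Z`. -/
theorem d_mul_z (hn : 4 ≤ n) : D * Z = ι (zetaConst 1) * C := by
  have h10 := one_ne_zero_of_le hn
  have h1 := val_one_of_le hn
  have h2 := val_two_of_le hn
  have h20 : (2 : Fin n) ≠ 0 := by rw [Ne, Fin.ext_iff, h2]; simp
  have h21 : (2 : Fin n) ≠ 1 := by rw [Ne, Fin.ext_iff, h1, h2]; simp
  obtain ⟨b, -, e⟩ := h.c_mul_z hn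
  have e1 : ι (zetaConst 2) * C = D * ι (zetaConst 2) := h.mul_c_of_avoid fun x hx => by
    by_cases hx0 : x = 0
    · rw [hx0, PTzeta_apply_zero, Option.some.injEq] at hx
      exact h10 hx.symm
    · rw [zetaConst_apply hx0 h20, Option.some.injEq] at hx
      exact h21 hx
  have e2 : zetaConst 2 * zetaLast = (zetaConst 1 : PTzeta n) := PTzeta_ext fun x hx => by
    rw [PTzeta_mul_apply, zetaConst_apply hx h20, Option.bind_some, zetaLast_apply hn h20,
      if_neg h21, zetaConst_apply hx h10]
  calc D * Z = D * ι (zetaConst 2) * Z := by rw [mul_assoc, h.const_mul_z h20]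
    _ = ι (zetaConst 2) * (C * Z) := by rw [← e1, mul_assoc]
    _ = ι (zetaConst 1) * C * ι b := by rw [e, ← mul_assoc, ← mul_assoc, ← map_mul, e2]
    _ = ι (zetaConst 1) * C := h.const_one_mul_c_mul hn b

theorem z_mul_const_mul_c (hn : 4 ≤ n) {y : Fin n} (hy0 : y ≠ 0) (hy1 : y ≠ 1) :
    Z * ι (zetaConst y) * C = ι zetaEmpty * Z * ι (zetaConst y) := by
  rw [mul_assoc, h.mul_c_of_avoid, ← mul_assoc, h.zd]
  intro x hx
  by_cases hx0 : x = 0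
  · rw [hx0, PTzeta_apply_zero, Option.some.injEq] at hx
    exact one_ne_zero_of_le hn hx.symm
  · rw [zetaConst_apply hx0 hy0, Option.some.injEq] at hx
    exact hy1 hx

/-- Evaluating `Z * C * Z` with `c_mul_z` shows that `Z * C` times `Z ^ 2` is `ι zetaEmpty`; the
factor `Z ^ 2` is then removed, since `Z * C` already absorbs `ι zetaEmpty` on the right. -/
theorem z_mul_c (hn : 4 ≤ n) : Z * C = ι zetaEmpty := by
  have h10 := one_ne_zero_of_le hn
  have h1 := val_one_of_le hn
  have hl0 : (Fin.rev 0 : Fin n) ≠ 0 := by rw [Ne, Fin.ext_iff, Fin.val_rev]; simp; omega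
  have hl1 : (Fin.rev 0 : Fin n) ≠ 1 := by rw [Ne, Fin.ext_iff, Fin.val_rev, h1]; simp; omega
  have hE : ∀ t : PTzeta n, zetaEmpty * t = zetaEmpty := fun t => PTzeta_ext fun x hx => by
    rw [PTzeta_mul_apply, zetaEmpty_apply hx]; rfl
  have hE' : (zetaConst 1 : PTzeta n) * zetaEmpty = zetaEmpty := PTzeta_ext fun x hx => by
    rw [PTzeta_mul_apply, zetaConst_apply hx h10, Option.bind_some, zetaEmpty_apply h10,
      zetaEmpty_apply hx]
  obtain ⟨b, hb, e⟩ := h.c_mul_z hn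
  have e1 : Z * C * Z = ι zetaEmpty * Z := by
    have e2 : Z * ι zetaLast = Z * ι (zetaConst (Fin.rev 0)) := h.z_mul_congr hn (by
      rw [zetaLast_apply hn h10, if_pos rfl, zetaConst_apply h10 hl0])
    have e3 : Z * ι (zetaConst (Fin.rev 0) * b) = Z * ι 1 := h.z_mul_congr hn (by
      rw [PTzeta_mul_apply, zetaConst_apply h10 hl0, Option.bind_some, hb]; rfl)
    rw [mul_assoc, e, ← mul_assoc, ← mul_assoc, e2, h.z_mul_const_mul_c hn hl0 hl1, mul_assoc,
      mul_assoc, ← map_mul, e3, map_one, mul_one]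
  have e2 : Z * C * ι (zetaConst 1) = ι zetaEmpty := by
    rw [← h.zz, ← mul_assoc, e1, mul_assoc, h.zz, ← map_mul, hE]
  calc Z * C = Z * (ι (zetaConst 1) * C) := by rw [← mul_assoc, h.z_mul_const_one hn]
    _ = Z * C * ι (zetaConst 1) * ι zetaEmpty := by
        rw [← h.const_one_mul_c_mul hn zetaEmpty, ← mul_assoc, ← mul_assoc, h.z_mul_const_one hn,
          mul_assoc (Z * C), ← map_mul, hE']
    _ = ι zetaEmpty := by rw [e2, ← map_mul, hE]

theorem z_mul_of_none (hn : 4 ≤ n) {s : PTzeta n} (hs : s.1 1 = none) :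
    Z * ι s = ι (zetaConst 1) * C := by
  rw [← h.d_mul_z hn, h.dz]
  exact h.z_mul_congr hn (by rw [hs, zetaRemoveOne_apply (one_ne_zero_of_le hn), if_pos rfl])

end IsStarModel

/-- The elements of the forms `t`, `dt`, `tcs` and `tzs`, with `t` and `s` from `PTzeta n`. -/
inductive IsStarForm (ι : PTzeta n →* P) (C D Z : P) : P → Prop
  | base (t : PTzeta n) : IsStarForm ι C D Z (ι t)
  | formD (t : PTzeta n) : IsStarForm ι C D Z (D * ι t)
  | formC (t s : PTzeta n) : IsStarForm ι C D Z (ι t * C * ι s)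
  | formZ (t s : PTzeta n) : IsStarForm ι C D Z (ι t * Z * ι s)

namespace IsStarForm

variable {ι : PTzeta n →* P} {C D Z : P}

theorem mul_base {p : P} (hp : IsStarForm ι C D Z p) (u : PTzeta n) :
    IsStarForm ι C D Z (p * ι u) := by
  cases hp with
  | base t => rw [← map_mul]; exact base _
  | formD t => rw [mul_assoc, ← map_mul]; exact formD _
  | formC t s => rw [mul_assoc, ← map_mul]; exact formC _ _
  | formZ t s => rw [mul_assoc, ← map_mul]; exact formZ _ _

theorem mul_d (h : IsStarModel ι C D Z) {p : P} (hp : IsStarForm ι C D Z p) :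
    IsStarForm ι C D Z (p * D) := by
  cases hp with
  | base t => rw [h.td]; exact formD _
  | formD t => rw [mul_assoc, h.td, ← mul_assoc, h.dd]; exact formD _
  | formC t s =>
    rw [mul_assoc, h.td, mul_assoc, ← mul_assoc C, h.cd, h.td, mul_assoc, ← mul_assoc, h.td,
      mul_assoc, ← map_mul, ← map_mul]
    exact formD _
  | formZ t s =>
    rw [mul_assoc, h.td, mul_assoc, ← mul_assoc Z, h.zd, ← mul_assoc, ← mul_assoc, ← map_mul]
    exact formZ _ _

theorem mul_c (hn : 4 ≤ n) (h : IsStarModel ι C D Z) {p : P} (hp : IsStarForm ι C D Z p) :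
    IsStarForm ι C D Z (p * C) := by
  have hbase : ∀ t, IsStarForm ι C D Z (ι t * C) := fun t => by
    have := formC (ι := ι) (C := C) (D := D) (Z := Z) t 1
    rwa [map_one, mul_one] at this
  cases hp with
  | base t => exact hbase t
  | formD t => rw [← h.td, mul_assoc, h.dc]; exact hbase t
  | formC t s =>
    have : ι t * C * ι s * C = ι (t * zetaRemoveOne * s) * C := by
      calc ι t * C * ι s * C = ι t * C * (ι s * D) * C := by
            rw [mul_assoc _ (ι s * D), mul_assoc (ι s), h.dc, ← mul_assoc]
        _ = ι t * (C * D) * ι s * C := by rw [h.td]; simp only [mul_assoc]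
        _ = ι (t * zetaRemoveOne) * (D * ι s) * C := by
            rw [h.cd, map_mul]; simp only [mul_assoc]
        _ = ι (t * zetaRemoveOne * s) * C := by
            rw [← h.td, map_mul _ _ s]; simp only [mul_assoc]; rw [h.dc]
    rw [this]
    exact hbase _
  | formZ t s =>
    have h10 := one_ne_zero_of_le hn
    rw [mul_assoc (ι t)]
    cases hs : s.1 1 with
    | none =>
      rw [h.z_mul_of_none hn hs, mul_assoc, mul_assoc, h.cc, ← mul_assoc, ← mul_assoc,
        ← map_mul, ← map_mul, h.td]
      exact formD _
    | some y =>
      have hy0 : y ≠ 0 := by rintro rfl; exact PTzeta_apply_ne s h10 hs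
      by_cases hy1 : y = 1
      · have : Z * ι s = Z * ι 1 := h.z_mul_congr hn (by rw [hs, hy1]; rfl)
        rw [this, map_one, mul_one, mul_assoc, h.z_mul_c hn, ← map_mul]
        exact base _
      · have : Z * ι s = Z * ι (zetaConst y) := h.z_mul_congr hn (by
          rw [hs, zetaConst_apply h10 hy0])
        rw [this, mul_assoc, h.z_mul_const_mul_c hn hy0 hy1, ← mul_assoc, ← mul_assoc, ← map_mul]
        exact formZ _ _

theorem mul_z (hn : 4 ≤ n) (h : IsStarModel ι C D Z) {p : P} (hp : IsStarForm ι C D Z p) :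
    IsStarForm ι C D Z (p * Z) := by
  have h10 := one_ne_zero_of_le hn
  cases hp with
  | base t =>
    have := formZ (ι := ι) (C := C) (D := D) (Z := Z) t 1
    rwa [map_one, mul_one] at this
  | formD t =>
    have := formC (ι := ι) (C := C) (D := D) (Z := Z) (t * zetaConst 1) 1
    rwa [map_one, mul_one, map_mul, mul_assoc, ← h.d_mul_z hn, ← mul_assoc, h.td] at this
  | formC t s =>
    set u : PTzeta n := zetaMk fun x => if x = 1 then some 1 else (zetaDom s.1).1 x with hu
    have hu1 : u.1 1 = some 1 := by simp [hu, zetaMk_apply _ h10, h10]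
    have hu2 : ∀ x, x ≠ 0 → x ≠ 1 → (zetaDom s.1).1 x = u.1 x := fun x hx hx1 => by
      simp [hu, zetaMk_apply _ hx, hx1, PTzeta_apply_ne _ hx]
    have hc : C * ι u = ι u * C := h.ct u hu1 fun x hx => by
      by_contra hx1
      by_cases hx0 : x = 0
      · rw [hx0, PTzeta_apply_zero, Option.some.injEq] at hx
        exact h10 hx.symm
      · rw [← hu2 x hx0 hx1, zetaDom_apply _ hx0] at hx
        split_ifs at hx
        exact hx1 (Option.some.inj hx)
    obtain ⟨b, -, e⟩ := h.c_mul_z hn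
    have : ι t * C * ι s * Z = ι (t * u * zetaLast) * C * ι b := by
      calc ι t * C * ι s * Z = ι t * (C * ι (zetaDom s.1)) * Z := by
            rw [mul_assoc, h.mul_z hn]; simp only [mul_assoc]
        _ = ι t * ι u * (C * Z) := by rw [h.c_mul_congr hu2, hc]; simp only [mul_assoc]
        _ = ι (t * u * zetaLast) * C * ι b := by rw [e, map_mul, map_mul]; simp only [mul_assoc]
    rw [this]
    exact formC _ _
  | formZ t s =>
    cases hs : s.1 1 with
    | none =>
      rw [mul_assoc (ι t), h.z_mul_of_none hn hs, ← h.d_mul_z hn, mul_assoc, mul_assoc, h.zz,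
        ← mul_assoc, h.td, mul_assoc, ← map_mul]
      exact formD _
    | some y =>
      have : Z * ι (zetaDom s.1) = Z * ι 1 := h.z_mul_congr hn (by
        rw [zetaDom_apply _ h10, hs]; rfl)
      rw [mul_assoc, h.mul_z hn s, mul_assoc, ← mul_assoc Z, this, map_one, mul_one, h.zz, ← map_mul]
      exact base _

end IsStarForm

end Model

/-! ### Normal forms -/

section GeneratorsOfPTzeta

variable {n : ℕ} [NeZero n]

theorem swap_mem_map_of_ne_zero (hn : 4 ≤ n) {S : Submonoid (PT (Fin n))}
    (ha : ta n ∈ S) (hb : tb n ∈ S) (x y : Fin n) (hx : x ∉ ({0} : Set (Fin n)))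
    (hy : y ∉ ({0} : Set (Fin n))) : ofPerm (Equiv.swap x y) ∈ S := by
  have h1 := val_one_of_le hn
  have h2 := val_two_of_le hn
  refine swap_mem_of_cycle_mem (r := 1) (s := 2) (by omega) (tb_eq_ofPerm hn ▸ hb)
    (ta_eq_ofPerm (n := n) ▸ ha) x y ?_ ?_
  all_goals
    simp only [Set.mem_singleton_iff, Fin.ext_iff, Fin.val_zero, Fin.le_def, h1] at *
    omega

theorem mem_of_generators_mem (hn : 4 ≤ n) (S : Submonoid (PTzeta n))
    (ha : ⟨ta n, ta_mem_PTzeta hn⟩ ∈ S) (hb : ⟨tb n, tb_mem_PTzeta hn⟩ ∈ S)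
    (he : ⟨te n, te_mem_PTzeta hn⟩ ∈ S) (hf : ⟨tf n, tf_mem_PTzeta hn⟩ ∈ S) (t : PTzeta n) :
    t ∈ S := by
  have h1 := val_one_of_le hn
  have h2 := val_two_of_le hn
  have hsub : fixer {0} ⊆ (S.map (PTzeta n).subtype : Set (PT (Fin n))) :=
    fixer_subset_of_swap_mem (p := 2) (q := 1) (r := 1)
      (swap_mem_map_of_ne_zero hn ⟨_, ha, rfl⟩ ⟨_, hb, rfl⟩)
      (by rw [Set.mem_singleton_iff, Fin.ext_iff, h2]; simp)
      (by rw [Set.mem_singleton_iff, Fin.ext_iff, h1]; simp) (by rw [Ne, Fin.ext_iff, h1, h2]; simp)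
      ⟨_, he, rfl⟩ (by rw [Set.mem_singleton_iff, Fin.ext_iff, h1]; simp) ⟨_, hf, rfl⟩
  obtain ⟨s, hs, e⟩ := hsub (PTzeta_subset_fixer t.2)
  rwa [← Subtype.ext e]

theorem full_mem_of_generators_mem (hn : 4 ≤ n) (S : Submonoid (PTzeta n))
    (ha : ⟨ta n, ta_mem_PTzeta hn⟩ ∈ S) (hb : ⟨tb n, tb_mem_PTzeta hn⟩ ∈ S)
    (he : ⟨te n, te_mem_PTzeta hn⟩ ∈ S) (t : PTzeta n) (ht : ∀ x, t.1 x ≠ none) : t ∈ S := by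
  have h1 := val_one_of_le hn
  have h2 := val_two_of_le hn
  have ht' : ∀ x, ∃ y, t.1 x = some y := fun x => Option.ne_none_iff_exists'.mp (ht x)
  choose g hg using ht'
  have e : t.1 = ⟨fun x => some (g x)⟩ := PT.ext_apply hg
  have hmem : (⟨fun x => some (g x)⟩ : PT (Fin n)) ∈ S.map (PTzeta n).subtype :=
    full_mem_of_swap_mem (S := S.map (PTzeta n).subtype) (F := {0}) (p := 2) (q := 1)
      (swap_mem_map_of_ne_zero hn ⟨_, ha, rfl⟩ ⟨_, hb, rfl⟩)
      (by rw [Set.mem_singleton_iff, Fin.ext_iff, h2]; simp)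
      (by rw [Set.mem_singleton_iff, Fin.ext_iff, h1]; simp) (by rw [Ne, Fin.ext_iff, h1, h2]; simp)
      ⟨_, he, rfl⟩ g (e ▸ PTzeta_subset_fixer t.2)
  obtain ⟨s, hs, e'⟩ := hmem
  rwa [← Subtype.ext (e'.trans e.symm)]

/-- The elements of `PTzeta n` that fix `1` and map no other point to `1` form a copy of the monoid
of all partial transformations of `{2, …, n - 1}`. -/
theorem mem_of_stabilizer_generators_mem (hn : 4 ≤ n) (S : Submonoid (PTzeta n))
    (hsw : ∃ t ∈ S, t.1 = ofPerm (Equiv.swap 2 3)) (hcyc : ∃ t ∈ S, t.1 = ofPerm (cyclePerm 2))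
    (he : ∃ t ∈ S, t.1 = collapse 3 2) (hf : ∃ t ∈ S, t.1 = remove 2)
    (t : PTzeta n) (ht : t.1 1 = some 1) (ht' : ∀ x, t.1 x = some 1 → x = 1) : t ∈ S := by
  have h1 := val_one_of_le hn
  have h2 := val_two_of_le hn
  have h3 := val_three_of_le hn
  have m2 : (2 : Fin n) ∉ ({0, 1} : Set (Fin n)) := by
    rw [Set.mem_insert_iff, Set.mem_singleton_iff, Fin.ext_iff, Fin.ext_iff, h1, h2]; simp
  have m3 : (3 : Fin n) ∉ ({0, 1} : Set (Fin n)) := by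
    rw [Set.mem_insert_iff, Set.mem_singleton_iff, Fin.ext_iff, Fin.ext_iff, h1, h3]; simp
  have hsub : fixer {0, 1} ⊆ (S.map (PTzeta n).subtype : Set (PT (Fin n))) := by
    refine fixer_subset_of_swap_mem (p := 3) (q := 2) (r := 2) (fun x y hx hy => ?_)
      m3 m2 (by rw [Ne, Fin.ext_iff, h2, h3]; simp) he m2 hf
    refine swap_mem_of_cycle_mem (r := 2) (s := 3) (by omega) hcyc hsw x y ?_ ?_
    all_goals
      simp only [Set.mem_insert_iff, Set.mem_singleton_iff, Fin.ext_iff, Fin.val_zero, Fin.le_def,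
        h1, h2] at *
      omega
  obtain ⟨s, hs, e⟩ := hsub (show t.1 ∈ fixer {0, 1} from by
    refine ⟨?_, fun x y hxy hy => ?_⟩
    · rintro x (rfl | rfl)
      · exact PTzeta_apply_zero t
      · exact ht
    · rcases hy with rfl | rfl
      · left
        by_contra hx
        exact PTzeta_apply_ne t hx hxy
      · exact Or.inr (ht' x hxy))
  rwa [← Subtype.ext e]

end GeneratorsOfPTzeta

section NormalForm

variable {n : ℕ} [NeZero n] {P : Type*} [Monoid P]

/-- For `α` undefined at `0` with `x₀α = 0`: the points that `α` sends to `0` go to `1`, the others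
are moved by the transposition `(1 x₀)`, which keeps them away from `1`. -/
def zetaPre (α : PT (Fin n)) (x₀ : Fin n) : PTzeta n :=
  zetaMk fun x => if α x = some 0 then some 1 else some (Equiv.swap 1 x₀ x)

/-- The transposition `(1 x₀)` followed by `α`, where `α` is not `0`. -/
def zetaPost (α : PT (Fin n)) (x₀ : Fin n) : PTzeta n :=
  zetaMk fun y => α (Equiv.swap 1 x₀ y)

open Classical in
/-- A representative in `P` of each partial endomorphism of the star: `t` if `0 ↦ 0`, `t z s` if
`0` has another image, and if `0` is outside the domain then `t c s` or `d t`, according to whether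
`0` is in the image or not. -/
noncomputable def normalForm (ι : PTzeta n →* P) (C D Z : P) (α : PT (Fin n)) : P :=
  match α 0 with
  | some y => if y = 0 then ι (zetaMk α) else ι (zetaDom α) * Z * ι (zetaConst y)
  | none =>
    if h : ∃ x, α x = some 0 then ι (zetaPre α h.choose) * C * ι (zetaPost α h.choose)
    else D * ι (zetaMk α)

section Eval

variable (ι : PTzeta n →* P) (C D Z : P) {α : PT (Fin n)}

theorem normalForm_of_zero (h : α 0 = some 0) : normalForm ι C D Z α = ι (zetaMk α) := by
  simp [normalForm, h]

theorem normalForm_of_some {y : Fin n} (h : α 0 = some y) (hy : y ≠ 0) :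
    normalForm ι C D Z α = ι (zetaDom α) * Z * ι (zetaConst y) := by
  simp [normalForm, h, hy]

theorem normalForm_of_avoid (h : α 0 = none) (h' : ∀ x, α x ≠ some 0) :
    normalForm ι C D Z α = D * ι (zetaMk α) := by
  simp [normalForm, h, h']

theorem normalForm_of_exists (h : α 0 = none) (h' : ∃ x, α x = some 0) :
    ∃ x₀, α x₀ = some 0 ∧ normalForm ι C D Z α = ι (zetaPre α x₀) * C * ι (zetaPost α x₀) :=
  ⟨h'.choose, h'.choose_spec, by simp only [normalForm, h]; rw [dif_pos h']⟩

end Eval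

theorem tc_apply_one (hn : 4 ≤ n) : tc n 1 = some 0 := by
  simp [tc, one_ne_zero_of_le hn]

theorem tc_apply {x : Fin n} (h0 : x ≠ 0) (h1 : x ≠ 1) : tc n x = some x := by
  simp [tc, h0, h1]

theorem td_apply {x : Fin n} (h0 : x ≠ 0) : td n x = some x := by
  simp [td, h0]

theorem tz_apply {x : Fin n} (h0 : x ≠ 0) : tz n x = some 0 := by
  simp [tz, h0]

theorem swap_one_ne_zero (hn : 4 ≤ n) {x₀ x : Fin n} (hx₀ : x₀ ≠ 0) (hx : x ≠ 0) :
    Equiv.swap 1 x₀ x ≠ 0 := by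
  intro e
  have : Equiv.swap 1 x₀ (0 : Fin n) = 0 :=
    Equiv.swap_apply_of_ne_of_ne (one_ne_zero_of_le hn).symm hx₀.symm
  exact hx ((Equiv.swap 1 x₀).injective (e.trans this.symm))

theorem zetaPre_apply (hn : 4 ≤ n) (α : PT (Fin n)) {x₀ x : Fin n} (hx₀ : x₀ ≠ 0) (hx : x ≠ 0) :
    (zetaPre α x₀).1 x = if α x = some 0 then some 1 else some (Equiv.swap 1 x₀ x) := by
  rw [zetaPre, zetaMk_apply _ hx, if_neg]
  split_ifs
  · simp [one_ne_zero_of_le hn]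
  · simp [swap_one_ne_zero hn hx₀ hx]

theorem zetaPost_apply (α : PT (Fin n)) (x₀ : Fin n) {x : Fin n} (hx : x ≠ 0) :
    (zetaPost α x₀).1 x =
      if α (Equiv.swap 1 x₀ x) = some 0 then none else α (Equiv.swap 1 x₀ x) := by
  rw [zetaPost, zetaMk_apply _ hx]

/-- `normalForm` names the right partial transformation. -/
theorem map_normalForm (hn : 4 ≤ n) {ι : PTzeta n →* P} {C D Z : P} (π : P →* PT (Fin n))
    (hι : ∀ t, π (ι t) = t.1) (hC : π C = tc n) (hD : π D = td n) (hZ : π Z = tz n)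
    {α : PT (Fin n)} (hα : α ∈ PEnd (star n)) : π (normalForm ι C D Z α) = α := by
  have h10 := one_ne_zero_of_le hn
  cases h0 : α 0 with
  | some y =>
    by_cases hy : y = 0
    · rw [normalForm_of_zero _ _ _ _ (hy ▸ h0), hι]
      refine PT.ext_apply fun x => ?_
      by_cases hx : x = 0
      · rw [hx, PTzeta_apply_zero, h0, hy]
      · rw [zetaMk_apply _ hx, if_neg]
        intro e
        have := hα 0 x y 0 h0 e (SimpleGraph.starGraph_center_adj (Ne.symm hx))
        rw [hy] at this
        exact this.ne rfl
    · rw [normalForm_of_some _ _ _ _ h0 hy, map_mul, map_mul, hι, hι, hZ]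
      refine PT.ext_apply fun x => ?_
      rw [PT.mul_apply, PT.mul_apply]
      by_cases hx : x = 0
      · rw [hx, PTzeta_apply_zero, h0]
        simp [tz, zetaConst_apply h10 hy]
      · rw [zetaDom_apply _ hx]
        cases hx' : α x with
        | none => simp
        | some w =>
          have := hα 0 x y w h0 hx' (SimpleGraph.starGraph_center_adj (Ne.symm hx))
          rw [SimpleGraph.starGraph_adj] at this
          rw [this.2.resolve_left hy]
          simp [tz_apply hx, PTzeta_apply_zero]
  | none =>
    by_cases h' : ∃ x, α x = some 0
    · obtain ⟨x₀, hx₀, e⟩ := normalForm_of_exists ι C D Z h0 h'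
      have hx₀0 : x₀ ≠ 0 := by rintro rfl; rw [h0] at hx₀; cases hx₀
      rw [e, map_mul, map_mul, hι, hι, hC]
      refine PT.ext_apply fun x => ?_
      rw [PT.mul_apply, PT.mul_apply]
      by_cases hx : x = 0
      · rw [hx, PTzeta_apply_zero, h0]; simp [tc]
      · rw [zetaPre_apply hn α hx₀0 hx]
        by_cases hx' : α x = some 0
        · rw [if_pos hx', hx', Option.bind_some, tc_apply_one hn, Option.bind_some,
            PTzeta_apply_zero]
        · have hs0 := swap_one_ne_zero hn hx₀0 hx
          have hs1 : Equiv.swap 1 x₀ x ≠ 1 := by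
            intro e
            have : x = x₀ := (Equiv.swap 1 x₀).injective (by rw [e, Equiv.swap_apply_right])
            exact hx' (this ▸ hx₀)
          rw [if_neg hx', Option.bind_some, tc_apply hs0 hs1, Option.bind_some,
            zetaPost_apply _ _ hs0, Equiv.swap_apply_self, if_neg hx']
    · push Not at h'
      rw [normalForm_of_avoid _ _ _ _ h0 h', map_mul, hι, hD]
      refine PT.ext_apply fun x => ?_
      rw [PT.mul_apply]
      by_cases hx : x = 0
      · rw [hx, h0]; simp [td]
      · rw [td_apply hx, Option.bind_some, zetaMk_apply _ hx, if_neg (h' x)]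

/-- An element of the form `tzs`, `tcs`, `dt` or `t` is determined by its image in `PT`. -/
theorem IsStarForm.normalForm_map (hn : 4 ≤ n) {ι : PTzeta n →* P} {C D Z : P}
    (h : IsStarModel ι C D Z) (π : P →* PT (Fin n))
    (hι : ∀ t, π (ι t) = t.1) (hC : π C = tc n) (hD : π D = td n) (hZ : π Z = tz n)
    {p : P} (hp : IsStarForm ι C D Z p) : normalForm ι C D Z (π p) = p := by
  have h10 := one_ne_zero_of_le hn
  have hformD : ∀ t, normalForm ι C D Z (π (D * ι t)) = D * ι t := fun t => by
    rw [map_mul, hι, hD]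
    have h0 : (td n * t.1) 0 = none := by simp [PT.mul_apply, td]
    have hx : ∀ x, x ≠ 0 → (td n * t.1) x = t.1 x := fun x hx => by
      rw [PT.mul_apply, td_apply hx, Option.bind_some]
    rw [normalForm_of_avoid _ _ _ _ h0]
    · congr 2
      exact PTzeta_ext fun x hx0 => by
        rw [zetaMk_apply _ hx0, hx x hx0, if_neg (PTzeta_apply_ne t hx0)]
    · intro x
      by_cases hx0 : x = 0
      · rw [hx0, h0]; simp
      · rw [hx x hx0]; exact PTzeta_apply_ne t hx0
  have hformC : ∀ t s, normalForm ι C D Z (π (ι t * C * ι s)) = ι t * C * ι s := fun t s => by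
    have h0 : (t.1 * tc n * s.1) 0 = none := by
      rw [PT.mul_apply, PT.mul_apply, PTzeta_apply_zero]; simp [tc]
    have hv1 : ∀ x, t.1 x = some 1 → (t.1 * tc n * s.1) x = some 0 := fun x hx => by
      rw [PT.mul_apply, PT.mul_apply, hx, Option.bind_some, tc_apply_one hn, Option.bind_some,
        PTzeta_apply_zero]
    have hv2 : ∀ x, x ≠ 0 → t.1 x ≠ some 1 →
        (t.1 * tc n * s.1) x = (t.1 x).bind s.1 ∧ (t.1 * tc n * s.1) x ≠ some 0 := by
      intro x hx hx1
      rw [PT.mul_apply, PT.mul_apply]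
      cases hy : t.1 x with
      | none => simp
      | some y =>
        have hy0 : y ≠ 0 := by rintro rfl; exact PTzeta_apply_ne t hx hy
        have hy1 : y ≠ 1 := by rintro rfl; exact hx1 hy
        rw [Option.bind_some, tc_apply hy0 hy1]
        exact ⟨rfl, PTzeta_apply_ne s hy0⟩
    by_cases hex : ∃ x, (t.1 * tc n * s.1) x = some 0
    · rw [map_mul, map_mul, hι, hι, hC]
      obtain ⟨x₀, hx₀, e⟩ := normalForm_of_exists ι C D Z h0 hex
      have hx₀0 : x₀ ≠ 0 := by rintro rfl; rw [h0] at hx₀; cases hx₀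
      have hx₀1 : t.1 x₀ = some 1 := by
        by_contra hne
        exact (hv2 x₀ hx₀0 hne).2 hx₀
      rw [e]
      set α := t.1 * tc n * s.1 with hα
      -- `t` is `zetaPre α x₀` followed by an element that commutes with `C`.
      set g : PTzeta n := zetaMk fun y => if y = 1 then some 1 else
        if t.1 (Equiv.swap 1 x₀ y) = some 1 then none else t.1 (Equiv.swap 1 x₀ y) with hg
      have hg1 : g.1 1 = some 1 := by simp [hg, zetaMk_apply _ h10, h10]
      have hg2 : ∀ y, y ≠ 0 → y ≠ 1 → g.1 y =
          if t.1 (Equiv.swap 1 x₀ y) = some 1 then none else t.1 (Equiv.swap 1 x₀ y) := by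
        intro y hy0 hy1
        have := PTzeta_apply_ne t (swap_one_ne_zero hn hx₀0 hy0)
        rw [hg, zetaMk_apply _ hy0, if_neg hy1, if_neg]
        split_ifs
        · simp
        · exact this
      have hcomm : C * ι g = ι g * C := h.ct g hg1 fun y hy => by
        by_contra hy1
        by_cases hy0 : y = 0
        · rw [hy0, PTzeta_apply_zero, Option.some.injEq] at hy
          exact h10 hy.symm
        · rw [hg2 y hy0 hy1] at hy
          split_ifs at hy with hc
          exact hc hy
      have ht : t = zetaPre α x₀ * g := PTzeta_ext fun x hx => by
        rw [PTzeta_mul_apply, zetaPre_apply hn α hx₀0 hx]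
        by_cases hx1 : t.1 x = some 1
        · rw [if_pos (hv1 x hx1), Option.bind_some, hg1, hx1]
        · have hs1 : Equiv.swap 1 x₀ x ≠ 1 := by
            intro e
            have : x = x₀ := (Equiv.swap 1 x₀).injective (by rw [e, Equiv.swap_apply_right])
            exact hx1 (this ▸ hx₀1)
          rw [if_neg (hv2 x hx hx1).2, Option.bind_some, hg2 _ (swap_one_ne_zero hn hx₀0 hx) hs1,
            Equiv.swap_apply_self, if_neg hx1]
      have hpost : C * ι (g * s) = C * ι (zetaPost α x₀) := h.c_mul_congr fun y hy0 hy1 => by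
        have hw0 := swap_one_ne_zero hn hx₀0 hy0
        rw [PTzeta_mul_apply, hg2 y hy0 hy1, zetaPost_apply _ _ hy0]
        by_cases hc : t.1 (Equiv.swap 1 x₀ y) = some 1
        · rw [if_pos hc, if_pos (hv1 _ hc)]; rfl
        · rw [if_neg hc, if_neg (hv2 _ hw0 hc).2, (hv2 _ hw0 hc).1]
      conv_rhs => rw [ht]
      rw [map_mul, mul_assoc (ι (zetaPre α x₀)) (ι g), ← hcomm, mul_assoc, mul_assoc, mul_assoc,
        ← map_mul, hpost]
    · have havoid : ∀ x, t.1 x ≠ some 1 := fun x hx => hex ⟨x, hv1 x hx⟩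
      rw [h.mul_c_of_avoid havoid, mul_assoc, ← map_mul, hformD]
  cases hp with
  | base t => rw [hι, normalForm_of_zero _ _ _ _ (PTzeta_apply_zero t), zetaMk_coe]
  | formD t => exact hformD t
  | formC t s => exact hformC t s
  | formZ t s =>
    cases hs : s.1 1 with
    | none =>
      have := hformC (t * zetaConst 1) 1
      rwa [map_one, mul_one, map_mul ι, mul_assoc, ← h.z_mul_of_none hn hs, ← mul_assoc] at this
    | some y =>
      have hy0 : y ≠ 0 := by rintro rfl; exact PTzeta_apply_ne s h10 hs
      rw [map_mul, map_mul, hι, hι, hZ]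
      have h0 : (t.1 * tz n * s.1) 0 = some y := by
        rw [PT.mul_apply, PT.mul_apply, PTzeta_apply_zero]
        simp [tz, hs]
      have hdom : zetaDom (t.1 * tz n * s.1) = zetaDom t.1 := PTzeta_ext fun x hx => by
        rw [zetaDom_apply _ hx, zetaDom_apply _ hx, PT.mul_apply, PT.mul_apply]
        cases hx' : t.1 x with
        | none => rfl
        | some w =>
          have hw0 : w ≠ 0 := by rintro rfl; exact PTzeta_apply_ne t hx hx'
          rw [Option.bind_some, tz_apply hw0, Option.bind_some, PTzeta_apply_zero]
          simp
      rw [normalForm_of_some _ _ _ _ h0 hy0, hdom, h.mul_z hn t, mul_assoc, mul_assoc]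
      congr 1
      exact h.z_mul_congr hn (by rw [zetaConst_apply h10 hy0, hs])

end NormalForm

/-! ### Soundness and completeness of the presentation -/

section Soundness

variable {n : ℕ} [NeZero n]

theorem zetaRemoveOne_coe (hn : 4 ≤ n) : (zetaRemoveOne : PTzeta n).1 = tf n := by
  refine PT.ext_apply fun x => ?_
  by_cases hx : x = 0
  · rw [hx, PTzeta_apply_zero, (tf_mem_PTzeta hn).1]
  · rw [zetaRemoveOne_apply hx]; rfl

set_option linter.unusedSimpArgs false in
/-- The transformations `c`, `d`, `z` satisfy the relations of the presentation. -/
theorem isStarModel_PT (hn : 4 ≤ n) :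
    IsStarModel (PTzeta n).subtype (tc n) (td n) (tz n) := by
  have h10 := one_ne_zero_of_le hn
  have htc0 : tc n 0 = none := by simp [tc]
  have htd0 : td n 0 = none := by simp [td]
  have htz0 : tz n 0 = some 1 := by simp [tz]
  have hf0 := PTzeta_apply_zero (zetaRemoveOne : PTzeta n)
  have hf1 : (zetaRemoveOne : PTzeta n).1 1 = none := by
    rw [zetaRemoveOne_apply h10, if_pos rfl]
  have hfx : ∀ x : Fin n, x ≠ 0 → x ≠ 1 → (zetaRemoveOne : PTzeta n).1 x = some x :=
    fun x hx hx1 => by rw [zetaRemoveOne_apply hx, if_neg hx1]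
  have htc1 := tc_apply_one hn
  -- Each relation is checked at the points `0`, `1` and `x` with `x ≠ 0, 1`.
  have ext3 : ∀ {α β : PT (Fin n)}, α 0 = β 0 → α 1 = β 1 →
      (∀ x, x ≠ 0 → x ≠ 1 → α x = β x) → α = β := fun {α β} h0 h1 hx =>
    PT.ext_apply fun x => by
      by_cases hx0 : x = 0
      · rw [hx0, h0]
      by_cases hx1 : x = 1
      · rw [hx1, h1]
      exact hx x hx0 hx1
  have hl0 : (Fin.rev 0 : Fin n) ≠ 0 := by rw [Ne, Fin.ext_iff, Fin.val_rev]; simp; omega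
  have hl1 : (Fin.rev 0 : Fin n) ≠ 1 := by
    rw [Ne, Fin.ext_iff, Fin.val_rev, val_one_of_le hn]; simp; omega
  refine ⟨?_, fun t => ?_, fun t ht => ?_, ?_, ?_, ?_, ?_, ?_, ?_, ?_, ?_, fun t ht ht' => ?_,
    fun t ht => ?_⟩
  all_goals try
    refine ext3 ?_ ?_ fun x hx0 hx1 => ?_ <;>
    simp [PT.mul_apply, htc0, htd0, htz0, htc1, hf0, hf1, td_apply, tz_apply, tc_apply, hfx,
      PTzeta_apply_zero, zetaConst_apply, zetaEmpty_apply, *]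
    done
  · refine PT.ext_apply fun x => ?_
    rw [PT.mul_apply, PT.mul_apply, Submonoid.subtype_apply]
    by_cases hx : x = 0
    · rw [hx, PTzeta_apply_zero, htd0, Option.bind_some, htd0]; rfl
    · rw [td_apply hx, Option.bind_some]
      cases hy : t.1 x with
      | none => rfl
      | some y =>
        have hy0 : y ≠ 0 := by rintro rfl; exact PTzeta_apply_ne t hx hy
        rw [Option.bind_some, td_apply hy0]
  · refine PT.ext_apply fun x => ?_
    rw [PT.mul_apply, Submonoid.subtype_apply]
    by_cases hx : x = 0
    · rw [hx, PTzeta_apply_zero, Option.bind_some]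
    · obtain ⟨y, hy⟩ := Option.ne_none_iff_exists'.mp (ht x)
      have hy0 : y ≠ 0 := by rintro rfl; exact PTzeta_apply_ne t hx hy
      rw [hy, Option.bind_some, tz_apply hy0, tz_apply hx]
  · refine ext3 ?_ ?_ fun x hx0 hx1 => ?_
    · simp [PT.mul_apply, htc0, PTzeta_apply_zero]
    · simp [PT.mul_apply, htc1, PTzeta_apply_zero, ht]
    · simp only [PT.mul_apply, tc_apply hx0 hx1, Option.bind_some, Submonoid.subtype_apply]
      cases hy : t.1 x with
      | none => rfl
      | some y =>
        have hy0 : y ≠ 0 := by rintro rfl; exact PTzeta_apply_ne t hx0 hy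
        have hy1 : y ≠ 1 := by rintro rfl; exact hx1 (ht' x hy)
        rw [Option.bind_some, tc_apply hy0 hy1]
  · have ht1 : t.1 1 = some (Fin.rev 0) := by
      rw [ht, tb_eq_ofPerm hn, ← ofPerm_pow, ofPerm_apply, Option.some.injEq, Fin.ext_iff,
        cyclePerm_one_pow_val hn (by omega), val_one_of_le hn, if_neg (by omega),
        if_pos (by omega), Fin.val_rev]
      simp; omega
    refine ext3 ?_ ?_ fun x hx0 hx1 => ?_
    · simp [PT.mul_apply, htc0, PTzeta_apply_zero]
    · simp [PT.mul_apply, htc1, htz0, ht1, zetaLast_apply hn h10, tc_apply hl0 hl1]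
    · simp [PT.mul_apply, tc_apply hx0 hx1, tz_apply hx0, PTzeta_apply_zero,
        zetaLast_apply hn hx0, hx1, htc1]

theorem PTzeta_le_PEnd : PTzeta n ≤ PEnd (star n) := by
  rintro α ⟨h0, hne⟩ u v u' v' hu hv huv
  rw [SimpleGraph.starGraph_adj] at huv ⊢
  obtain ⟨huv, rfl | rfl⟩ := huv
  · rw [h0, Option.some.injEq] at hu
    subst hu
    refine ⟨?_, Or.inl rfl⟩
    rintro rfl
    exact hne v (Ne.symm huv) hv
  · rw [h0, Option.some.injEq] at hv
    subst hv
    refine ⟨?_, Or.inr rfl⟩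
    rintro rfl
    exact hne u huv hu

theorem gen_mem_PEnd (hn : 4 ≤ n) (x : Letter) : gen n x ∈ PEnd (star n) := by
  have hcenter : ∀ α : PT (Fin n), α 0 = none → α ∈ PEnd (star n) := by
    intro α h0 u v u' v' hu hv huv
    rw [SimpleGraph.starGraph_adj] at huv
    obtain ⟨-, rfl | rfl⟩ := huv
    · rw [h0] at hu; cases hu
    · rw [h0] at hv; cases hv
  cases x with
  | a0 => exact PTzeta_le_PEnd (ta_mem_PTzeta hn)
  | b0 => exact PTzeta_le_PEnd (tb_mem_PTzeta hn)
  | e0 => exact PTzeta_le_PEnd (te_mem_PTzeta hn)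
  | f0 => exact PTzeta_le_PEnd (tf_mem_PTzeta hn)
  | c => exact hcenter _ (by simp [gen, tc])
  | d => exact hcenter _ (by simp [gen, td])
  | z =>
    have h10 := one_ne_zero_of_le hn
    intro u v u' v' hu hv huv
    rw [SimpleGraph.starGraph_adj] at huv ⊢
    simp only [gen, tz] at hu hv
    obtain ⟨huv, rfl | rfl⟩ := huv
    · simp only [if_true, if_neg (Ne.symm huv), Option.some.injEq] at hu hv
      subst hu hv
      exact ⟨h10, Or.inr rfl⟩
    · simp only [if_true, if_neg huv, Option.some.injEq] at hu hv
      subst hu hv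
      exact ⟨h10.symm, Or.inl rfl⟩

theorem lift_gen_map_incl (w : FreeMonoid Letter0) :
    FreeMonoid.lift (gen n) (FreeMonoid.map Letter0.incl w) = FreeMonoid.lift (gen0 n) w := by
  have : (FreeMonoid.lift (gen n)).comp (FreeMonoid.map Letter0.incl) =
      FreeMonoid.lift (gen0 n) := FreeMonoid.hom_eq fun x => by cases x <;> rfl
  exact DFunLike.congr_fun this w

theorem lift_eq_of_defines {X N : Type*} [Monoid N] {R : Set (FreeMonoid X × FreeMonoid X)}
    {g : X → N} {M : Submonoid N} (h : Defines R g M) {u v : FreeMonoid X} (huv : (u, v) ∈ R) :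
    FreeMonoid.lift g u = FreeMonoid.lift g v := by
  obtain ⟨φ, hφ⟩ := h
  have e : (M.subtype.comp φ.toMonoidHom).comp (Con.mk' _) = FreeMonoid.lift g :=
    FreeMonoid.hom_eq fun x => hφ x
  have hmk : Con.mk' (conGen fun u v : FreeMonoid X => (u, v) ∈ R) u = Con.mk' _ v :=
    (Con.eq _).mpr (ConGen.Rel.of u v huv)
  rw [← e]
  exact congrArg (M.subtype.comp φ.toMonoidHom) hmk

theorem lift_gen_eq_of_mem_Rc (hn : 4 ≤ n) {R₀ : Set (FreeMonoid Letter0 × FreeMonoid Letter0)}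
    (hR₀ : Defines R₀ (gen0 n) (PTzeta n)) {u v : FreeMonoid Letter} (huv : (u, v) ∈ Rc n R₀) :
    FreeMonoid.lift (gen n) u = FreeMonoid.lift (gen n) v := by
  have h := isStarModel_PT hn
  have h10 := one_ne_zero_of_le hn
  have hf := zetaRemoveOne_coe hn
  have hct : ∀ α : PT (Fin n), α ∈ PTzeta n → α 1 = some 1 → (∀ x, α x = some 1 → x = 1) →
      tc n * α = α * tc n := fun α hα h1 h2 => h.ct ⟨α, hα⟩ h1 h2
  have h1 := val_one_of_le hn
  have h2 := val_two_of_le hn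
  have h3 := val_three_of_le hn
  have ma := ta_mem_PTzeta hn
  have mb := tb_mem_PTzeta hn
  have me := te_mem_PTzeta hn
  have mf := tf_mem_PTzeta hn
  have n12 : (1 : Fin n) ≠ 2 := by rw [Ne, Fin.ext_iff, h1, h2]; simp
  have n13 : (1 : Fin n) ≠ 3 := by rw [Ne, Fin.ext_iff, h1, h3]; simp
  have hperm : ∀ σ : Equiv.Perm (Fin n), σ 1 = 1 →
      ofPerm σ 1 = some 1 ∧ ∀ x, ofPerm σ x = some 1 → x = 1 := fun σ hσ =>
    ⟨by rw [ofPerm_apply, hσ], fun x hx => σ.injective ((Option.some.inj hx).trans hσ.symm)⟩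
  have full : ∀ α : PT (Fin n), α ∈ PTzeta n → (∀ x, α x ≠ none) → α * tz n = tz n :=
    fun α hα hx => h.tz ⟨α, hα⟩ hx
  simp only [Rc, Rs, Rd, Set.mem_union, Set.mem_insert_iff, Set.mem_singleton_iff,
    Prod.mk.injEq] at huv
  rcases huv with ((huv | huv) | huv) | huv
  · obtain ⟨⟨u', v'⟩, huv', e⟩ := huv
    simp only [Prod.map_apply, Prod.mk.injEq] at e
    rw [← e.1, ← e.2, lift_gen_map_incl, lift_gen_map_incl]
    exact lift_eq_of_defines hR₀ huv'
  · rcases huv with ⟨rfl, rfl⟩ | ⟨rfl, rfl⟩ | ⟨rfl, rfl⟩ | ⟨rfl, rfl⟩ | ⟨rfl, rfl⟩ <;>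
      simp only [map_mul, map_pow, FreeMonoid.lift_eval_of, gen]
    · rw [sq]; exact h.dd
    · exact h.td ⟨_, ma⟩
    · exact h.td ⟨_, mb⟩
    · exact h.td ⟨_, me⟩
    · exact h.td ⟨_, mf⟩
  · rcases huv with ⟨rfl, rfl⟩ | ⟨rfl, rfl⟩ | ⟨rfl, rfl⟩ | ⟨rfl, rfl⟩ | ⟨rfl, rfl⟩ | ⟨rfl, rfl⟩ |
      ⟨rfl, rfl⟩ <;> simp only [map_mul, map_pow, FreeMonoid.lift_eval_of, gen]
    · exact full _ ma fun x => by rw [ta_eq_ofPerm, ofPerm_apply]; simp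
    · exact full _ mb fun x => by rw [tb_eq_ofPerm hn, ofPerm_apply]; simp
    · exact full _ me fun x => by rw [te_eq_collapse, collapse_apply]; split_ifs <;> simp
    · rw [← hf]; exact h.dz
    · rw [tf_mul_tb_pow hn]; exact h.zd
    · rw [sq, te_mul_tb_pow_mul_te hn]; exact h.zz
    · rw [tf_mul_tb_pow hn]
      refine PT.ext_apply fun x => ?_
      simp only [PT.mul_apply]
      by_cases hx : x = 0
      · simp [hx, td]
      · rw [td_apply hx, Option.bind_some, zetaEmpty_apply hx]; rfl
  · rcases huv with ⟨rfl, rfl⟩ | ⟨rfl, rfl⟩ | ⟨rfl, rfl⟩ | ⟨rfl, rfl⟩ | ⟨rfl, rfl⟩ | ⟨rfl, rfl⟩ |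
      ⟨rfl, rfl⟩ | ⟨rfl, rfl⟩ | ⟨rfl, rfl⟩ | ⟨rfl, rfl⟩ <;>
      simp only [map_mul, map_pow, FreeMonoid.lift_eval_of, gen]
    · rw [sq, ← hf]; exact h.cc
    · rw [← hf]; exact h.cf
    · rw [← hf]; exact h.fc
    · rw [← hf]; exact h.cd
    · exact h.dc
    · have e := tb_pow_mul_ta_mul_tb hn
      have := hct _ (mul_mem (mul_mem (pow_mem mb (n - 2)) ma) mb)
        (by rw [e]; exact (hperm _ (Equiv.swap_apply_of_ne_of_ne n12 n13)).1)
        (by rw [e]; exact (hperm _ (Equiv.swap_apply_of_ne_of_ne n12 n13)).2)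
      simpa only [mul_assoc] using this
    · have e := tb_mul_ta hn
      have e1 : cyclePerm (2 : Fin n) 1 = 1 := by
        rw [cyclePerm_apply, cycleFun, if_pos (by rw [Fin.lt_def, h1, h2]; omega)]
      have := hct _ (mul_mem mb ma) (by rw [e]; exact (hperm _ e1).1)
        (by rw [e]; exact (hperm _ e1).2)
      simpa only [mul_assoc] using this
    · have e := ta_mul_tf_mul_ta (n := n)
      have := hct _ (mul_mem (mul_mem ma mf) ma)
        (by rw [e, remove_apply, if_neg n12])
        (by
          rw [e]
          intro x hx
          rw [remove_apply] at hx
          split_ifs at hx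
          exact Option.some.inj hx)
      simpa only [mul_assoc] using this
    · have e := collapse_three_two_eq hn
      have := hct _ (mul_mem (mul_mem (mul_mem (mul_mem (mul_mem (mul_mem (mul_mem (mul_mem ma
        (pow_mem mb (n - 2))) ma) mb) me) (pow_mem mb (n - 2))) ma) mb) ma)
        (by rw [e, collapse_apply, if_neg n13])
        (by
          rw [e]
          intro x hx
          rw [collapse_apply] at hx
          split_ifs at hx
          · exact absurd (Option.some.inj hx) n12.symm
          · exact Option.some.inj hx)
      simpa only [mul_assoc] using this
    · rw [ta_mul_tb_mul_te_pow hn]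
      exact h.czb ⟨_, pow_mem mb (n - 2)⟩ rfl

end Soundness

section Completeness

variable {n : ℕ} [NeZero n]

/-- The relations of the presentation say enough about all of `PTzeta n`, since the elements `t`
for which each of them holds form a submonoid. -/
theorem isStarModel_of_relations (hn : 4 ≤ n)
    {R₀ : Set (FreeMonoid Letter0 × FreeMonoid Letter0)} {P : Type*} [Monoid P]
    (m : FreeMonoid Letter →* P) (hm : ∀ u v, (u, v) ∈ Rc n R₀ → m u = m v)
    (ι : PTzeta n →* P) (ha : ι ⟨ta n, ta_mem_PTzeta hn⟩ = m a₀)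
    (hb : ι ⟨tb n, tb_mem_PTzeta hn⟩ = m b₀) (he : ι ⟨te n, te_mem_PTzeta hn⟩ = m e₀)
    (hf : ι ⟨tf n, tf_mem_PTzeta hn⟩ = m f₀) : IsStarModel ι (m c) (m d) (m z) := by
  have hd : ∀ {u v}, (u, v) ∈ ({(d ^ 2, d), (a₀ * d, d * a₀), (b₀ * d, d * b₀), (e₀ * d, d * e₀),
      (f₀ * d, d * f₀)} : Set (FreeMonoid Letter × FreeMonoid Letter)) → m u = m v :=
    fun h => hm _ _ (Or.inl (Or.inl (Or.inr h)))
  have hz : ∀ {u v}, (u, v) ∈ ({(a₀ * z, z), (b₀ * z, z), (e₀ * z, z), (d * z, z * f₀),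
      (z * d, (f₀ * b₀) ^ (n - 1) * z), (z ^ 2, (e₀ * b₀) ^ (n - 3) * e₀),
      (d * (f₀ * b₀) ^ (n - 1) * z, d * (f₀ * b₀) ^ (n - 1))} :
      Set (FreeMonoid Letter × FreeMonoid Letter)) → m u = m v :=
    fun h => hm _ _ (Or.inl (Or.inr h))
  have hc : ∀ {u v}, (u, v) ∈ ({(c ^ 2, f₀ * d), (c * f₀, c), (f₀ * c, f₀ * d), (c * d, f₀ * d),
      (d * c, c), (c * b₀ ^ (n - 2) * a₀ * b₀, b₀ ^ (n - 2) * a₀ * b₀ * c),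
      (c * b₀ * a₀, b₀ * a₀ * c), (c * a₀ * f₀ * a₀, a₀ * f₀ * a₀ * c),
      (c * a₀ * b₀ ^ (n - 2) * a₀ * b₀ * e₀ * b₀ ^ (n - 2) * a₀ * b₀ * a₀,
        a₀ * b₀ ^ (n - 2) * a₀ * b₀ * e₀ * b₀ ^ (n - 2) * a₀ * b₀ * a₀ * c),
      (c * z * b₀ ^ (n - 2), a₀ * (b₀ * e₀) ^ (n - 3) * c)} :
      Set (FreeMonoid Letter × FreeMonoid Letter)) → m u = m v :=
    fun h => hm _ _ (Or.inr h)
  have hf' : ι zetaRemoveOne = m f₀ := by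
    rw [← hf]; exact congrArg ι (Subtype.ext (zetaRemoveOne_coe hn))
  set A : PTzeta n := ⟨ta n, ta_mem_PTzeta hn⟩ with hA
  set B : PTzeta n := ⟨tb n, tb_mem_PTzeta hn⟩ with hB
  set E : PTzeta n := ⟨te n, te_mem_PTzeta hn⟩ with hE
  set F : PTzeta n := ⟨tf n, tf_mem_PTzeta hn⟩ with hF
  have hω : ι zetaEmpty = m ((f₀ * b₀) ^ (n - 1)) := by
    rw [map_pow, map_mul, ← hf, ← hb, ← map_mul, ← map_pow]
    exact congrArg ι (Subtype.ext (tf_mul_tb_pow hn).symm)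
  have hκ : ι (zetaConst 1) = m ((e₀ * b₀) ^ (n - 3) * e₀) := by
    rw [map_mul, map_pow, map_mul, ← he, ← hb, ← map_mul, ← map_pow, ← map_mul]
    exact congrArg ι (Subtype.ext (te_mul_tb_pow_mul_te hn).symm)
  have hL : ι zetaLast = m (a₀ * (b₀ * e₀) ^ (n - 3)) := by
    rw [map_mul, map_pow, map_mul, ← ha, ← he, ← hb, ← map_mul, ← map_pow, ← map_mul]
    exact congrArg ι (Subtype.ext (ta_mul_tb_mul_te_pow hn).symm)
  refine
    { dd := ?_, td := ?_, tz := ?_, dz := ?_, zd := ?_, zz := ?_, cc := ?_, cf := ?_, fc := ?_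
      cd := ?_, dc := ?_, ct := ?_, czb := ?_ }
  · rw [← sq, ← map_pow]; exact hd (by simp)
  · let S : Submonoid (PTzeta n) :=
      { carrier := {t | ι t * m d = m d * ι t}
        one_mem' := by simp
        mul_mem' := fun {s t} (hs : ι s * m d = m d * ι s) (ht : ι t * m d = m d * ι t) => by
          change ι (s * t) * m d = m d * ι (s * t)
          rw [map_mul, mul_assoc, ht, ← mul_assoc, hs, mul_assoc] }
    refine mem_of_generators_mem hn S ?_ ?_ ?_ ?_
    · change ι A * m d = m d * ι A
      rw [ha, ← map_mul, ← map_mul]; exact hd (by simp)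
    · change ι B * m d = m d * ι B
      rw [hb, ← map_mul, ← map_mul]; exact hd (by simp)
    · change ι E * m d = m d * ι E
      rw [he, ← map_mul, ← map_mul]; exact hd (by simp)
    · change ι F * m d = m d * ι F
      rw [hf, ← map_mul, ← map_mul]; exact hd (by simp)
  · let S : Submonoid (PTzeta n) :=
      { carrier := {t | ι t * m z = m z}
        one_mem' := by simp
        mul_mem' := fun {s t} (hs : ι s * m z = m z) (ht : ι t * m z = m z) => by
          change ι (s * t) * m z = m z
          rw [map_mul, mul_assoc, ht, hs] }
    refine full_mem_of_generators_mem hn S ?_ ?_ ?_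
    · change ι A * m z = m z
      rw [ha, ← map_mul]; exact hz (by simp)
    · change ι B * m z = m z
      rw [hb, ← map_mul]; exact hz (by simp)
    · change ι E * m z = m z
      rw [he, ← map_mul]; exact hz (by simp)
  · rw [hf', ← map_mul, ← map_mul]; exact hz (by simp)
  · rw [hω, ← map_mul, ← map_mul]; exact hz (by simp)
  · rw [hκ, ← map_mul, ← sq]; exact hz (by simp)
  · rw [hf', ← map_mul, ← map_mul, ← sq]; exact hc (by simp)
  · rw [hf', ← map_mul]; exact hc (by simp)
  · rw [hf', ← map_mul, ← map_mul]; exact hc (by simp)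
  · rw [hf', ← map_mul, ← map_mul]; exact hc (by simp)
  · rw [← map_mul]; exact hc (by simp)
  · let S : Submonoid (PTzeta n) :=
      { carrier := {t | m c * ι t = ι t * m c}
        one_mem' := by simp
        mul_mem' := fun {s t} (hs : m c * ι s = ι s * m c) (ht : m c * ι t = ι t * m c) => by
          change m c * ι (s * t) = ι (s * t) * m c
          rw [map_mul, ← mul_assoc, hs, mul_assoc, ht, mul_assoc] }
    refine mem_of_stabilizer_generators_mem hn S ⟨B ^ (n - 2) * A * B, ?_, tb_pow_mul_ta_mul_tb hn⟩
      ⟨B * A, ?_, tb_mul_ta hn⟩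
      ⟨A * B ^ (n - 2) * A * B * E * B ^ (n - 2) * A * B * A, ?_, collapse_three_two_eq hn⟩
      ⟨A * F * A, ?_, ta_mul_tf_mul_ta⟩
    · have := hc (Or.inr <| Or.inr <| Or.inr <| Or.inr <| Or.inr <| Or.inl rfl)
      simp only [map_mul, map_pow, ← ha, ← hb] at this
      change m c * ι (B ^ (n - 2) * A * B) = ι (B ^ (n - 2) * A * B) * m c
      simpa only [map_mul, map_pow, mul_assoc] using this
    · have := hc (Or.inr <| Or.inr <| Or.inr <| Or.inr <| Or.inr <| Or.inr <| Or.inl rfl)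
      simp only [map_mul, ← ha, ← hb] at this
      change m c * ι (B * A) = ι (B * A) * m c
      simpa only [map_mul, map_pow, mul_assoc] using this
    · have := hc (Or.inr <| Or.inr <| Or.inr <| Or.inr <| Or.inr <| Or.inr <| Or.inr <| Or.inr <| Or.inl rfl)
      simp only [map_mul, map_pow, ← ha, ← hb, ← he] at this
      change m c * ι (A * B ^ (n - 2) * A * B * E * B ^ (n - 2) * A * B * A) = ι (A * B ^ (n - 2) * A * B * E * B ^ (n - 2) * A * B * A) * m c
      simpa only [map_mul, map_pow, mul_assoc] using this
    · have := hc (Or.inr <| Or.inr <| Or.inr <| Or.inr <| Or.inr <| Or.inr <| Or.inr <| Or.inl rfl)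
      simp only [map_mul, ← ha, ← hf] at this
      change m c * ι (A * F * A) = ι (A * F * A) * m c
      simpa only [map_mul, map_pow, mul_assoc] using this
  · intro t ht
    have e : t = B ^ (n - 2) := Subtype.ext ht
    rw [e, hL, map_pow, hb, ← map_mul, ← map_pow, ← map_mul, ← map_mul]
    exact hc (by simp)

/-- The set of these forms contains `1` and is closed under right multiplication by the letters. -/
theorem isStarForm_of_word {P : Type*} [Monoid P] (hn : 4 ≤ n) {m : FreeMonoid Letter →* P}
    {ι : PTzeta n →* P} (h : IsStarModel ι (m c) (m d) (m z))
    (hι : ∀ x : Letter0, ∃ t, ι t = m (FreeMonoid.of x.incl)) (w : FreeMonoid Letter) :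
    IsStarForm ι (m c) (m d) (m z) (m w) := by
  suffices H : ∀ w v, IsStarForm ι (m c) (m d) (m z) (m v) →
      IsStarForm ι (m c) (m d) (m z) (m (v * w)) by
    have := H w 1 (by rw [map_one, ← map_one ι]; exact .base 1)
    rwa [one_mul] at this
  intro w
  induction w using FreeMonoid.inductionOn' with
  | one => intro v hv; rwa [mul_one]
  | of_mul x w ih =>
    intro v hv
    rw [← mul_assoc]
    apply ih
    rw [map_mul]
    have h0 : ∀ x : Letter0,
        IsStarForm ι (m c) (m d) (m z) (m v * m (FreeMonoid.of x.incl)) := fun x => by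
      obtain ⟨t, ht⟩ := hι x
      rw [← ht]
      exact hv.mul_base t
    cases x with
    | a0 => exact h0 .a0
    | b0 => exact h0 .b0
    | e0 => exact h0 .e0
    | f0 => exact h0 .f0
    | c => exact hv.mul_c hn h
    | d => exact hv.mul_d h
    | z => exact hv.mul_z hn h

end Completeness

end StarPres

/-- For every `n ≥ 4` and every set `R₀` of relations that defines, on the generators
`a₀, b₀, e₀, f₀`, the copy of the monoid of all partial transformations of `{1, …, n - 1}`, the
presentation `⟨a₀, b₀, e₀, f₀, c, d, z ∣ R_c⟩` defines the monoid of partial endomorphisms of the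
star graph `S_n`. -/
theorem theorem5p6 (n : ℕ) [NeZero n] (hn : 4 ≤ n)
    (R₀ : Set (FreeMonoid StarPres.Letter0 × FreeMonoid StarPres.Letter0))
    (hR₀ : StarPres.Defines R₀ (StarPres.gen0 n) (StarPres.PTzeta n)) :
    StarPres.Defines (StarPres.Rc n R₀) (StarPres.gen n) (StarPres.PEnd (StarPres.star n)) := by
  open StarPres in
  have hsound : ∀ u v, (u, v) ∈ Rc n R₀ →
      FreeMonoid.lift (gen n) u = FreeMonoid.lift (gen n) v :=
    fun u v => lift_gen_eq_of_mem_Rc hn hR₀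
  obtain ⟨φ, hφ⟩ := hR₀
  set K := conGen fun u v : FreeMonoid Letter => (u, v) ∈ Rc n R₀ with hK
  have hm : ∀ u v, (u, v) ∈ Rc n R₀ → K.mk' u = K.mk' v := fun u v huv =>
    (Con.eq K).mpr (ConGen.Rel.of u v huv)
  let π : K.Quotient →* PT (Fin n) := K.lift (FreeMonoid.lift (gen n)) (Con.conGen_le.mpr hsound)
  have hπ : ∀ x, π (K.mk' (FreeMonoid.of x)) = gen n x := fun x => rfl
  let ι₀ : (conGen fun u v : FreeMonoid Letter0 => (u, v) ∈ R₀).Quotient →* K.Quotient :=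
    Con.lift _ (K.mk'.comp (FreeMonoid.map Letter0.incl)) (Con.conGen_le.mpr fun u v huv =>
      hm _ _ (Or.inl (Or.inl (Or.inl ⟨(u, v), huv, rfl⟩))))
  let ι : PTzeta n →* K.Quotient := ι₀.comp φ.symm.toMonoidHom
  have hι₀ : ∀ (x : Letter0) (h : gen0 n x ∈ PTzeta n),
      ι ⟨gen0 n x, h⟩ = K.mk' (FreeMonoid.of x.incl) := fun x h => by
    have e : φ.symm ⟨gen0 n x, h⟩ = (FreeMonoid.of x : FreeMonoid Letter0) := by
      rw [MulEquiv.symm_apply_eq]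
      exact Subtype.ext (hφ x).symm
    change ι₀ (φ.symm ⟨gen0 n x, h⟩) = _
    rw [e]
    rfl
  have h := isStarModel_of_relations hn K.mk' hm ι (hι₀ .a0 (ta_mem_PTzeta hn))
    (hι₀ .b0 (tb_mem_PTzeta hn)) (hι₀ .e0 (te_mem_PTzeta hn)) (hι₀ .f0 (tf_mem_PTzeta hn))
  have hform : ∀ p : K.Quotient, IsStarForm ι (K.mk' c) (K.mk' d) (K.mk' z) p := fun p => by
    obtain ⟨w, rfl⟩ := Con.mk'_surjective p
    refine isStarForm_of_word hn h (fun x => ?_) w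
    cases x with
    | a0 => exact ⟨_, hι₀ .a0 (ta_mem_PTzeta hn)⟩
    | b0 => exact ⟨_, hι₀ .b0 (tb_mem_PTzeta hn)⟩
    | e0 => exact ⟨_, hι₀ .e0 (te_mem_PTzeta hn)⟩
    | f0 => exact ⟨_, hι₀ .f0 (tf_mem_PTzeta hn)⟩
  have hι : ∀ t, π (ι t) = t.1 := by
    refine mem_of_generators_mem hn (MonoidHom.eqLocusM (π.comp ι) (PTzeta n).subtype) ?_ ?_ ?_ ?_
    · exact congrArg π (hι₀ .a0 (ta_mem_PTzeta hn))
    · exact congrArg π (hι₀ .b0 (tb_mem_PTzeta hn))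
    · exact congrArg π (hι₀ .e0 (te_mem_PTzeta hn))
    · exact congrArg π (hι₀ .f0 (tf_mem_PTzeta hn))
  have hmem : ∀ p, π p ∈ PEnd (star n) := fun p => by
    obtain ⟨w, rfl⟩ := Con.mk'_surjective p
    induction w using FreeMonoid.inductionOn' with
    | one => rw [map_one, map_one]; exact one_mem _
    | of_mul x w ih =>
      rw [map_mul, map_mul, hπ]
      exact mul_mem (gen_mem_PEnd hn x) ih
  refine ⟨MulEquiv.ofBijective (π.codRestrict _ hmem) ⟨fun p q hpq => ?_, fun α => ?_⟩, hπ⟩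
  · have hpq' : π p = π q := congrArg Subtype.val hpq
    rw [← (hform p).normalForm_map hn h π hι (hπ .c) (hπ .d) (hπ .z), hpq',
      (hform q).normalForm_map hn h π hι (hπ .c) (hπ .d) (hπ .z)]
  · exact ⟨_, Subtype.ext (map_normalForm hn π hι (hπ .c) (hπ .d) (hπ .z) α.2)⟩
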